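/- Let $N\ge 3$, $0<s<1$, $2\le p<\frac Ns$, $0<\gamma<1$, and put $p^*:=\frac{Np}{N-sp}$. Let $$D^{s,p}(\mathbb{R}^N):=\{u\in L^{p^*}(\mathbb{R}^N):\ \|u\|_{s,p}<\infty\},\qquad \|u\|_{s,p}:=\Big(\int_{\mathbb{R}^N\times\mathbb{R}^N}\frac{|u(x)-u(y)|^p}{|x-y|^{N+sp}}\,dx\,dy\Big)^{1/p},$$ normed by $\|\cdot\|_{s,p}$. Let $a:\mathbb{R}^N\to[0,\infty)$ be measurable and satisfy $0\le a(x)\le \frac{c_a}{1+|x|^{N+\alpha}}$ for all $x\in\mathbb{R}^N$, where $c_a>0$ and $\alpha\in\big(\gamma\frac{N-sp}{p-1},\,\gamma\frac{N-sp}{p-1}+sp\big)$. Write $t_+:=\max\{t,0\}$ and, for every integer $n\ge1$, $$A_n(x,t):=\int_0^t a(x)\Big(\tau_++\frac1n\Big)^{-\gamma}d\tau,\qquad J_n(u):=\frac1p\|u\|_{s,p}^p-\int_{\mathbb{R}^N}A_n(x,u(x))\,dx,\quad u\in D^{s,p}(\mathbb{R}^N).$$ Then: (i) For every $n\ge1$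 the functional $J_n$ is well defined (that is, $A_n(\cdot,u)\in L^1(\mathbb{R}^N)$ for every $u\in D^{s,p}(\mathbb{R}^N)$), of class $C^1$, lower semicontinuous for the weak topology of $D^{s,p}(\mathbb{R}^N)$, and coercive, i.e. $J_n(u)\to+\infty$ as $\|u\|_{s,p}\to\infty$. (ii) There is a sequence $\{u_n\}_{n\ge1}\subset D^{s,p}(\mathbb{R}^N)$ such that, for every $n\ge1$, $u_n\ge0$ a.e. in $\mathbb{R}^N$, $J_n(u_n)=\min_{D^{s,p}(\mathbb{R}^N)}J_n$, and $u_n$ is a weak solution of $(-\Delta_p)^su=a(x)\big(u_++\frac1n\big)^{-\gamma}$ in $\mathbb{R}^N$, i.e., for all $v\in D^{s,p}(\mathbb{R}^N)$, both integrals below converge absolutely and $$\int_{\mathbb{R}^N\times\mathbb{R}^N}\frac{|u_n(x)-u_n(y)|^{p-2}(u_n(x)-u_n(y))(v(x)-v(y))}{|x-y|^{N+sp}}\,dx\,dy=\int_{\mathbb{R}^N}a(x)\Big((u_n)_+(x)+\frac1n\Big)^{-\gamma}v(x)\,dx.$$ Moreover, $\{u_n\}$ is bounded in $D^{s,p}(\mathbb{R}^N)$: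 there is $M$, independent of $n$, with $\|u_n\|_{s,p}\le M$ for all $n\ge1$. -/

import Mathlib

open MeasureTheory Filter Topology
open scoped ENNReal

noncomputable section

/-- The Euclidean space `ℝ^N`. -/
abbrev RN (N : ℕ) : Type := EuclideanSpace ℝ (Fin N)

/-- The standing restrictions on the dimension and the exponents:
`N ≥ 3`, `0 < s < 1` and `2 ≤ p < N / s`. -/
class Admissible (N : ℕ) (s p : ℝ) : Prop where
  three_le : 3 ≤ N
  s_pos : 0 < s
  s_lt_one : s < 1
  two_le : 2 ≤ p
  lt_div : p < N / s

/-- The critical exponent `p^* = N p / (N - s p)`. -/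
def critExp (N : ℕ) (s p : ℝ) : ℝ := N * p / (N - s * p)

/-- The Gagliardo seminorm
`[u]_{s,p} = (∫∫ |u(x) - u(y)|^p / |x - y|^{N + s p} dx dy)^{1/p}`, with values in `[0, ∞]`. -/
def gagliardo {N : ℕ} (s p : ℝ) (u : RN N → ℝ) : ℝ≥0∞ :=
  (∫⁻ z : RN N × RN N,
    ENNReal.ofReal (|u z.1 - u z.2| ^ p / ‖z.1 - z.2‖ ^ ((N : ℝ) + s * p))) ^ (1 / p)

/-- The difference quotient whose `L^p(ℝ^{2N})` norm is the Gagliardo seminorm. -/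
def diffQuot {N : ℕ} (s p : ℝ) (u : RN N → ℝ) (z : RN N × RN N) : ℝ :=
  (u z.1 - u z.2) / ‖z.1 - z.2‖ ^ (((N : ℝ) + s * p) / p)

section Gagliardo

variable {N : ℕ} {s p : ℝ}

theorem Admissible.p_pos [h : Admissible N s p] : 0 < p := by
  have := h.two_le
  linarith

theorem Admissible.critExp_pos [h : Admissible N s p] : 0 < critExp N s p := by
  have h1 : (3 : ℝ) ≤ N := by exact_mod_cast h.three_le
  have h2 := (lt_div_iff₀ h.s_pos).1 h.lt_div
  have h3 := h.two_le
  unfold critExp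
  apply div_pos
  · nlinarith
  · nlinarith

theorem gagliardo_eq_eLpNorm (hp : 0 < p) (u : RN N → ℝ) :
    gagliardo s p u = eLpNorm (diffQuot s p u) (ENNReal.ofReal p) volume := by
  rw [eLpNorm_eq_lintegral_rpow_enorm_toReal (by simpa using hp) ENNReal.ofReal_ne_top,
    ENNReal.toReal_ofReal hp.le, gagliardo]
  congr 1
  refine lintegral_congr fun z => ?_
  rw [Real.enorm_eq_ofReal_abs, ENNReal.ofReal_rpow_of_nonneg (abs_nonneg _) hp.le]
  congr 1
  rw [diffQuot, abs_div, abs_of_nonneg (Real.rpow_nonneg (norm_nonneg _) _),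
    Real.div_rpow (abs_nonneg _) (Real.rpow_nonneg (norm_nonneg _) _),
    ← Real.rpow_mul (norm_nonneg _), div_mul_cancel₀ _ hp.ne']

theorem diffQuot_congr {u v : RN N → ℝ} (h : u =ᵐ[volume] v) :
    diffQuot s p u =ᵐ[volume] diffQuot s p v := by
  rw [Measure.volume_eq_prod]
  have h1 := (Measure.quasiMeasurePreserving_fst
    (μ := (volume : Measure (RN N))) (ν := (volume : Measure (RN N)))).ae_eq_comp h
  have h2 := (Measure.quasiMeasurePreserving_snd
    (μ := (volume : Measure (RN N))) (ν := (volume : Measure (RN N)))).ae_eq_comp h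
  filter_upwards [h1, h2] with z hz1 hz2
  simp only [Function.comp] at hz1 hz2
  simp [diffQuot, hz1, hz2]

theorem aestronglyMeasurable_diffQuot {u : RN N → ℝ} (h : AEStronglyMeasurable u volume) :
    AEStronglyMeasurable (diffQuot s p u) volume := by
  rw [Measure.volume_eq_prod]
  have h1 := h.comp_quasiMeasurePreserving (Measure.quasiMeasurePreserving_fst
    (μ := (volume : Measure (RN N))) (ν := (volume : Measure (RN N))))
  have h2 := h.comp_quasiMeasurePreserving (Measure.quasiMeasurePreserving_snd
    (μ := (volume : Measure (RN N))) (ν := (volume : Measure (RN N))))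
  have h3 : Measurable fun z : RN N × RN N => ‖z.1 - z.2‖ ^ (((N : ℝ) + s * p) / p) := by
    fun_prop
  exact ((h1.sub h2).aemeasurable.div h3.aemeasurable).aestronglyMeasurable

theorem diffQuot_add (u v : RN N → ℝ) :
    diffQuot s p (u + v) = diffQuot s p u + diffQuot s p v := by
  funext z
  simp only [diffQuot, Pi.add_apply]
  ring

theorem diffQuot_smul (c : ℝ) (u : RN N → ℝ) :
    diffQuot s p (c • u) = c • diffQuot s p u := by
  funext z
  simp only [diffQuot, Pi.smul_apply, smul_eq_mul]
  ring

theorem gagliardo_congr (hp : 0 < p) {u v : RN N → ℝ} (h : u =ᵐ[volume] v) :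
    gagliardo s p u = gagliardo s p v := by
  rw [gagliardo_eq_eLpNorm hp, gagliardo_eq_eLpNorm hp, eLpNorm_congr_ae (diffQuot_congr h)]

theorem gagliardo_add_le (hp : 1 ≤ p) {u v : RN N → ℝ} (hu : AEStronglyMeasurable u volume)
    (hv : AEStronglyMeasurable v volume) :
    gagliardo s p (u + v) ≤ gagliardo s p u + gagliardo s p v := by
  have hp0 : 0 < p := by linarith
  simp only [gagliardo_eq_eLpNorm hp0, diffQuot_add]
  exact eLpNorm_add_le (aestronglyMeasurable_diffQuot hu) (aestronglyMeasurable_diffQuot hv)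
    (by simpa using hp)

theorem gagliardo_smul (hp : 0 < p) (c : ℝ) (u : RN N → ℝ) :
    gagliardo s p (c • u) = ‖c‖ₑ * gagliardo s p u := by
  simp only [gagliardo_eq_eLpNorm hp, diffQuot_smul]
  exact eLpNorm_const_smul _ _ _ _

theorem gagliardo_zero (hp : 0 < p) : gagliardo s p (0 : RN N → ℝ) = 0 := by
  have := gagliardo_smul (N := N) (s := s) hp 0 0
  simpa using this

/-- A function in `L^q(ℝ^N)`, `0 < q < ∞`, with vanishing Gagliardo seminorm is zero a.e. -/
theorem ae_eq_zero_of_gagliardo_eq_zero [h : Admissible N s p] {q : ℝ} (hq : 0 < q)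
    {u : RN N → ℝ} (hu : MemLp u (ENNReal.ofReal q) volume) (h0 : gagliardo s p u = 0) :
    u =ᵐ[volume] 0 := by
  have hp : 0 < p := Admissible.p_pos (N := N) (s := s)
  rw [gagliardo_eq_eLpNorm hp, eLpNorm_eq_zero_iff
    (aestronglyMeasurable_diffQuot hu.1) (by simpa using hp), Measure.volume_eq_prod] at h0
  have h1 := Measure.ae_ae_of_ae_prod h0
  obtain ⟨x, hx⟩ := h1.exists
  have h2 : u =ᵐ[volume] fun _ => u x := by
    filter_upwards [hx] with y hy
    by_cases hxy : x = y
    · rw [hxy]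
    · have hne : ‖x - y‖ ^ (((N : ℝ) + s * p) / p) ≠ 0 :=
        (Real.rpow_pos_of_pos (norm_pos_iff.2 (sub_ne_zero.2 hxy)) _).ne'
      simp only [diffQuot, Pi.zero_apply, div_eq_zero_iff, hne, or_false] at hy
      linarith
  have h3 := (memLp_congr_ae h2).1 hu
  rw [memLp_const_iff (by simpa using hq) ENNReal.ofReal_ne_top] at h3
  have : Nonempty (Fin N) := ⟨⟨0, by have := h.three_le; omega⟩⟩
  rcases h3 with h3 | h3
  · filter_upwards [h2] with y hy
    rw [hy, h3]
    rfl
  · simp at h3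

end Gagliardo

/-- The functions of the homogeneous fractional Sobolev space
`D^{s,p}(ℝ^N) = {u ∈ L^{p^*}(ℝ^N) : [u]_{s,p} < ∞}`, as a subspace of `L^{p^*}(ℝ^N)`. -/
def homSobolevSubmodule (N : ℕ) (s p : ℝ) [h : Admissible N s p] :
    Submodule ℝ (Lp ℝ (ENNReal.ofReal (critExp N s p)) (volume : Measure (RN N))) where
  carrier := {u | gagliardo s p (u : RN N → ℝ) < ∞}
  zero_mem' := by
    have hp : 0 < p := Admissible.p_pos (N := N) (s := s)
    simp only [Set.mem_ofPred_eq]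
    rw [gagliardo_congr hp (Lp.coeFn_zero _ _ _), gagliardo_zero hp]
    exact ENNReal.zero_lt_top
  add_mem' := by
    intro u v hu hv
    have hp : 0 < p := Admissible.p_pos (N := N) (s := s)
    simp only [Set.mem_ofPred_eq] at *
    rw [gagliardo_congr hp (Lp.coeFn_add _ _)]
    exact (gagliardo_add_le (by linarith [h.two_le]) (Lp.aestronglyMeasurable _)
      (Lp.aestronglyMeasurable _)).trans_lt (ENNReal.add_lt_top.2 ⟨hu, hv⟩)
  smul_mem' := by
    intro c u hu
    have hp : 0 < p := Admissible.p_pos (N := N) (s := s)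
    simp only [Set.mem_ofPred_eq] at *
    rw [gagliardo_congr hp (Lp.coeFn_smul _ _), gagliardo_smul hp]
    exact ENNReal.mul_lt_top (by simp) hu

/-- The homogeneous fractional Sobolev space `D^{s,p}(ℝ^N)`. It is a separate type, so that it
carries the Gagliardo norm below and not the norm of `L^{p^*}(ℝ^N)`. -/
def HomSobolev (N : ℕ) (s p : ℝ) [Admissible N s p] : Type := homSobolevSubmodule N s p

namespace HomSobolev

variable {N : ℕ} {s p : ℝ} [Admissible N s p]

instance : AddCommGroup (HomSobolev N s p) :=
  inferInstanceAs (AddCommGroup (homSobolevSubmodule N s p))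

instance : Module ℝ (HomSobolev N s p) :=
  inferInstanceAs (Module ℝ (homSobolevSubmodule N s p))

/-- An element of `D^{s,p}(ℝ^N)` as a function on `ℝ^N` (a representative of its a.e. class). -/
def toFun (u : HomSobolev N s p) : RN N → ℝ :=
  ((u.1 : Lp ℝ (ENNReal.ofReal (critExp N s p)) (volume : Measure (RN N))) : RN N → ℝ)

instance : CoeFun (HomSobolev N s p) (fun _ => RN N → ℝ) := ⟨toFun⟩

theorem memLp (u : HomSobolev N s p) :
    MemLp u (ENNReal.ofReal (critExp N s p)) volume := Lp.memLp u.1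

theorem gagliardo_lt_top (u : HomSobolev N s p) : gagliardo s p u < ∞ := u.2

theorem coe_add (u v : HomSobolev N s p) : ⇑(u + v) =ᵐ[volume] ⇑u + ⇑v :=
  Lp.coeFn_add u.1 v.1

theorem coe_smul (c : ℝ) (u : HomSobolev N s p) : ⇑(c • u) =ᵐ[volume] c • ⇑u :=
  Lp.coeFn_smul c u.1

theorem coe_zero : ⇑(0 : HomSobolev N s p) =ᵐ[volume] 0 :=
  Lp.coeFn_zero _ _ _

theorem ext_ae {u v : HomSobolev N s p} (h : ⇑u =ᵐ[volume] ⇑v) : u = v :=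
  Subtype.ext (Lp.ext h)

/-- The norm `‖u‖_{s,p} = [u]_{s,p}` of `D^{s,p}(ℝ^N)`. -/
instance : Norm (HomSobolev N s p) := ⟨fun u => (gagliardo s p u).toReal⟩

theorem norm_def (u : HomSobolev N s p) : ‖u‖ = (gagliardo s p u).toReal := rfl

theorem norm_smul_eq (c : ℝ) (u : HomSobolev N s p) : ‖c • u‖ = ‖c‖ * ‖u‖ := by
  have hp : 0 < p := Admissible.p_pos (N := N) (s := s)
  rw [norm_def, norm_def, gagliardo_congr hp (coe_smul c u), gagliardo_smul hp,
    ENNReal.toReal_mul, toReal_enorm]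

theorem normedSpaceCore : NormedSpace.Core ℝ (HomSobolev N s p) where
  norm_nonneg _ := ENNReal.toReal_nonneg
  norm_smul := norm_smul_eq
  norm_triangle u v := by
    have hp : 0 < p := Admissible.p_pos (N := N) (s := s)
    have h2 : 2 ≤ p := Admissible.two_le N s
    rw [norm_def, norm_def, norm_def, gagliardo_congr hp (coe_add u v),
      ← ENNReal.toReal_add u.gagliardo_lt_top.ne v.gagliardo_lt_top.ne]
    exact ENNReal.toReal_mono
      (ENNReal.add_lt_top.2 ⟨u.gagliardo_lt_top, v.gagliardo_lt_top⟩).ne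
      (gagliardo_add_le (by linarith) u.memLp.1 v.memLp.1)
  norm_eq_zero_iff u := by
    have hp : 0 < p := Admissible.p_pos (N := N) (s := s)
    constructor
    · intro h
      rw [norm_def, ENNReal.toReal_eq_zero_iff, or_iff_left u.gagliardo_lt_top.ne] at h
      exact ext_ae ((ae_eq_zero_of_gagliardo_eq_zero (Admissible.critExp_pos (N := N))
        u.memLp h).trans coe_zero.symm)
    · rintro rfl
      rw [norm_def, gagliardo_congr hp coe_zero, gagliardo_zero hp, ENNReal.toReal_zero]

instance : NormedAddCommGroup (HomSobolev N s p) :=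
  NormedAddCommGroup.ofCore normedSpaceCore

instance : NormedSpace ℝ (HomSobolev N s p) := NormedSpace.ofCore normedSpaceCore

end HomSobolev

/-- The weight `w(x) = 1 / (1 + |x|^{N + α})`. -/
def weight {N : ℕ} (α : ℝ) (x : RN N) : ℝ := 1 / (1 + ‖x‖ ^ ((N : ℝ) + α))

/-- The regularized reaction `a(x) (t_+ + 1/n)^{-γ}`. -/
def regReaction {N : ℕ} (a : RN N → ℝ) (γ : ℝ) (n : ℕ) (x : RN N) (t : ℝ) : ℝ :=
  a x * (max t 0 + 1 / (n : ℝ)) ^ (-γ)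

/-- Its primitive `A(x,t) = ∫_0^t a(x) (τ_+ + 1/n)^{-γ} dτ`. -/
def regPrimitive {N : ℕ} (a : RN N → ℝ) (γ : ℝ) (n : ℕ) (x : RN N) (t : ℝ) : ℝ :=
  ∫ τ in (0 : ℝ)..t, regReaction a γ n x τ

/-- The energy functional `J_n(u) = (1/p) ‖u‖_{s,p}^p - ∫ A(x, u(x)) dx` on `D^{s,p}(ℝ^N)`. -/
def energy {N : ℕ} {s p : ℝ} [Admissible N s p] (a : RN N → ℝ) (γ : ℝ) (n : ℕ)
    (u : HomSobolev N s p) : ℝ :=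
  1 / p * ‖u‖ ^ p - ∫ x, regPrimitive a γ n x (u x)

/-- The integrand
`|u(x) - u(y)|^{p-2} (u(x) - u(y)) (v(x) - v(y)) / |x - y|^{N + s p}` of `⟨(-Δ_p)^s u, v⟩`. -/
def fracPLaplacianIntegrand {N : ℕ} (s p : ℝ) (u v : RN N → ℝ) (z : RN N × RN N) : ℝ :=
  |u z.1 - u z.2| ^ (p - 2) * (u z.1 - u z.2) * (v z.1 - v z.2) /
    ‖z.1 - z.2‖ ^ ((N : ℝ) + s * p)

/-- `u ∈ D^{s,p}(ℝ^N)` is a weak solution of `(-Δ_p)^s u = g(x, u)` in `ℝ^N`: for every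
`v ∈ D^{s,p}(ℝ^N)` both sides of the weak formulation converge and they are equal. -/
def IsWeakSolution {N : ℕ} {s p : ℝ} [Admissible N s p] (g : RN N → ℝ → ℝ)
    (u : HomSobolev N s p) : Prop :=
  ∀ v : HomSobolev N s p,
    Integrable (fracPLaplacianIntegrand s p u v) ∧
    Integrable (fun x => g x (u x) * v x) ∧
    ∫ z, fracPLaplacianIntegrand s p u v z = ∫ x, g x (u x) * v x

end

/-! The regularized kernel `(t_+ + 1/n)^{-γ}` is nonincreasing in `t`, so its primitive is concave
and `J_n` is a convex functional minus a concave one. Since `p ≥ 2`, Clarkson's first inequality,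
transported by the isometry `u ↦ diffQuot s p u` into `L^p(ℝ^{2N})`, makes `J_n` uniformly convex
(`energy_half_add_le`). A minimizing sequence is therefore Cauchy and the minimum is attained with
no appeal to weak compactness. Weak lower semicontinuity is Mazur's theorem for a convex continuous
function.

Smoothness comes from one general fact: `f ↦ ∫ φ(f)` is `C^1` on `L^q`, `q ≥ 2`, when `φ'` is
Lipschitz with a weight of growth `q - 2` (`contDiff_integral`). It serves twice: with `φ(t) =
|t|^p` on `L^p(ℝ^{2N})`, and with the primitive of the kernel on `L^2(a dx)`, where `q = 2`. The
passage from `D^{s,p}` to `L^2(a dx)` needs the fractional Sobolev inequality, because `a` is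
bounded and integrable and `2 ≤ p < p^*`. The same inequality gives completeness of `D^{s,p}`.

Replacing `u` by `|u|` does not raise the energy, so a nonnegative minimizer exists, and the
vanishing of the derivative there is the weak formulation. The bound uniform in `n` follows from
`J_n(u_n) ≤ J_n(0) = 0` and an estimate of the primitive that is free of `n`, available because `γ <
1`. -/

noncomputable section

/-! ### Scalar functions with power-Lipschitz derivative -/

/-- A function `φ` with `φ 0 = 0` whose derivative `ψ` satisfies a Lipschitz estimate with a
weight of power growth. -/
structure HasPowerLipschitzDeriv (q C : ℝ) (φ ψ : ℝ → ℝ) : Prop where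
  two_le : 2 ≤ q
  nonneg : 0 ≤ C
  map_zero : φ 0 = 0
  hasDerivAt : ∀ t, HasDerivAt φ (ψ t) t
  abs_sub_le : ∀ a b, |ψ a - ψ b| ≤ C * ((|a| + |b|) ^ (q - 2) * |a - b|)

namespace HasPowerLipschitzDeriv

variable {q C : ℝ} {φ ψ : ℝ → ℝ}

/-- Mean value inequality for `x ↦ φ x - ψ t * x` on the segment from `t` to `t + h`. The remainder
is kept as a product of powers `q - 2`, `1`, `1`, the shape needed for three-factor Hölder. -/
theorem abs_taylor_le (H : HasPowerLipschitzDeriv q C φ ψ) (t h : ℝ) :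
    |φ (t + h) - φ t - ψ t * h| ≤ C * ((2 * |t| + |h|) ^ (q - 2) * |h| * |h|) := by
  have hq : 0 ≤ q - 2 := by linarith [H.two_le]
  have h1 := Convex.norm_image_sub_le_of_norm_hasDerivWithin_le (𝕜 := ℝ)
    (f := fun x => φ x - ψ t * x) (f' := fun x => ψ x - ψ t) (s := Set.uIcc t (t + h))
    (x := t) (y := t + h) (C := C * ((2 * |t| + |h|) ^ (q - 2) * |h|))
    (fun x _ => by
      simpa using
        ((H.hasDerivAt x).fun_sub ((hasDerivAt_id x).const_mul (ψ t))).hasDerivWithinAt)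
    (fun x hx => by
      have hxt : |x - t| ≤ |h| := by
        have := Set.abs_sub_left_of_mem_uIcc hx
        simpa using this
      have hx2 : |x| + |t| ≤ 2 * |t| + |h| := by
        have := abs_add_le (x - t) t
        rw [sub_add_cancel] at this
        linarith
      refine (H.abs_sub_le x t).trans (mul_le_mul_of_nonneg_left ?_ H.nonneg)
      exact mul_le_mul (Real.rpow_le_rpow (by positivity) hx2 hq) hxt (abs_nonneg _)
        (by positivity))
    (convex_uIcc _ _) Set.left_mem_uIcc Set.right_mem_uIcc
  simp only [Real.norm_eq_abs, add_sub_cancel_left] at h1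
  calc _ = |φ (t + h) - ψ t * (t + h) - (φ t - ψ t * t)| := by congr 1; ring
    _ ≤ _ := h1
    _ = _ := by ring

theorem abs_sub_linear_le (H : HasPowerLipschitzDeriv q C φ ψ) (t : ℝ) :
    |φ t - ψ 0 * t| ≤ C * (|t| ^ (q - 2) * |t| * |t|) := by
  simpa [H.map_zero] using H.abs_taylor_le 0 t

theorem continuous (H : HasPowerLipschitzDeriv q C φ ψ) : Continuous φ :=
  continuous_iff_continuousAt.2 fun t => (H.hasDerivAt t).continuousAt

theorem continuous_deriv (H : HasPowerLipschitzDeriv q C φ ψ) : Continuous ψ := by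
  have hq : 0 ≤ q - 2 := by linarith [H.two_le]
  refine continuous_iff_continuousAt.2 fun t => ?_
  rw [ContinuousAt, tendsto_iff_norm_sub_tendsto_zero]
  have h1 : Tendsto (fun x => C * ((|x| + |t|) ^ (q - 2) * |x - t|)) (𝓝 t) (𝓝 0) := by
    have : Continuous fun x => C * ((|x| + |t|) ^ (q - 2) * |x - t|) :=
      continuous_const.mul (((by fun_prop : Continuous fun x => |x| + |t|).rpow_const
        fun _ => Or.inr hq).mul (by fun_prop))
    simpa using this.tendsto t
  exact squeeze_zero (fun _ => norm_nonneg _) (fun x => H.abs_sub_le x t) h1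

end HasPowerLipschitzDeriv

/-- Bernoulli's inequality with exponent `q - 1` at `b / a = 1 + (b - a) / a`, multiplied by `a ^ (q
- 1)`. -/
theorem abs_rpow_sub_two_mul_sub_le_of_nonneg {q a b : ℝ} (hq : 2 ≤ q) (hb : 0 ≤ b)
    (hab : b ≤ a) :
    |a ^ (q - 2) * a - b ^ (q - 2) * b| ≤ (q - 1) * ((a + b) ^ (q - 2) * (a - b)) := by
  have hq0 : 0 ≤ q - 2 := by linarith
  rcases hab.eq_or_lt with rfl | hlt
  · simp
  have ha : 0 < a := hb.trans_lt hlt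
  have e : ∀ x : ℝ, 0 ≤ x → x ^ (q - 2) * x = x ^ (q - 1) := fun x hx => by
    conv_lhs => rw [← Real.rpow_add_one' hx (by linarith : q - 2 + 1 ≠ 0)]
    ring_nf
  have hm : b ^ (q - 2) * b ≤ a ^ (q - 2) * a :=
    mul_le_mul (Real.rpow_le_rpow hb hab hq0) hab hb (by positivity)
  rw [abs_of_nonneg (by linarith)]
  have h1 := one_add_mul_self_le_rpow_one_add (s := (b - a) / a)
    (by rw [le_div_iff₀ ha]; linarith) (p := q - 1) (by linarith)
  have h2 : 1 + (b - a) / a = b / a := by field_simp; ring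
  rw [h2, Real.div_rpow hb ha.le, ← e a ha.le, ← e b hb, le_div_iff₀ (by positivity)] at h1
  have h3 : (1 + (q - 1) * ((b - a) / a)) * (a ^ (q - 2) * a)
      = a ^ (q - 2) * a - (q - 1) * (a ^ (q - 2) * (a - b)) := by field_simp; ring
  have h4 : a ^ (q - 2) * (a - b) ≤ (a + b) ^ (q - 2) * (a - b) :=
    mul_le_mul_of_nonneg_right (Real.rpow_le_rpow ha.le (by linarith) hq0) (by linarith)
  have h5 := mul_le_mul_of_nonneg_left h4 (by linarith : 0 ≤ q - 1)
  linarith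

theorem abs_rpow_sub_two_mul_sub_le_of_opposite {q a b : ℝ} (hq : 2 ≤ q) (ha : 0 ≤ a)
    (hb : 0 ≤ b) :
    |a ^ (q - 2) * a + b ^ (q - 2) * b| ≤ (q - 1) * ((a + b) ^ (q - 2) * (a + b)) := by
  have hq0 : 0 ≤ q - 2 := by linarith
  have h1 : a ^ (q - 2) ≤ (a + b) ^ (q - 2) := Real.rpow_le_rpow ha (by linarith) hq0
  have h2 : b ^ (q - 2) ≤ (a + b) ^ (q - 2) := Real.rpow_le_rpow hb (by linarith) hq0
  rw [abs_of_nonneg (by positivity)]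
  have h3 : 0 ≤ (a + b) ^ (q - 2) * (a + b) := by positivity
  nlinarith [mul_le_mul_of_nonneg_right h1 ha, mul_le_mul_of_nonneg_right h2 hb]

theorem abs_abs_rpow_sub_two_mul_sub_le {q : ℝ} (hq : 2 ≤ q) (a b : ℝ) :
    |(|a| ^ (q - 2) * a) - |b| ^ (q - 2) * b| ≤
      (q - 1) * ((|a| + |b|) ^ (q - 2) * |a - b|) := by
  wlog hab : |b| ≤ |a| generalizing a b
  · have := this b a (le_of_not_ge hab)
    rwa [abs_sub_comm, abs_sub_comm a b, add_comm |a|]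
  rcases le_total 0 a with ha | ha <;> rcases le_total 0 b with hb | hb
  · rw [abs_of_nonneg ha, abs_of_nonneg hb] at *
    rw [abs_of_nonneg (sub_nonneg.2 hab)]
    exact abs_rpow_sub_two_mul_sub_le_of_nonneg hq hb hab
  · rw [abs_of_nonneg ha, abs_of_nonpos hb] at *
    have := abs_rpow_sub_two_mul_sub_le_of_opposite hq ha (neg_nonneg.2 hb)
    rw [abs_of_nonneg (by linarith : 0 ≤ a - b)]
    convert! this using 2
    ring
  · rw [abs_of_nonpos ha, abs_of_nonneg hb] at *
    have := abs_rpow_sub_two_mul_sub_le_of_opposite hq (neg_nonneg.2 ha) hb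
    rw [abs_of_nonpos (by linarith : a - b ≤ 0), ← abs_neg]
    convert! this using 2
    · ring
    · ring
  · rw [abs_of_nonpos ha, abs_of_nonpos hb] at *
    have := abs_rpow_sub_two_mul_sub_le_of_nonneg hq (neg_nonneg.2 hb) hab
    rw [abs_of_nonpos (by linarith : a - b ≤ 0), ← abs_neg]
    convert! this using 2
    · ring
    · ring

theorem hasPowerLipschitzDeriv_abs_rpow {q : ℝ} (hq : 2 ≤ q) :
    HasPowerLipschitzDeriv q (q * (q - 1)) (fun t => |t| ^ q) (fun t => q * |t| ^ (q - 2) * t) where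
  two_le := hq
  nonneg := by nlinarith
  map_zero := by simp [Real.zero_rpow (by linarith : q ≠ 0)]
  hasDerivAt t := hasDerivAt_abs_rpow t (by linarith)
  abs_sub_le a b := by
    have h := mul_le_mul_of_nonneg_left (abs_abs_rpow_sub_two_mul_sub_le hq a b)
      (by linarith : 0 ≤ q)
    rw [← abs_of_nonneg (by linarith : 0 ≤ q), ← abs_mul, abs_of_nonneg (by linarith : 0 ≤ q)] at h
    calc _ = |q * (|a| ^ (q - 2) * a - |b| ^ (q - 2) * b)| := by congr 1; ring
      _ ≤ _ := h
      _ = _ := by ring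

/-! ### Three-factor Hölder inequality -/

section Holder

variable {X : Type*} [MeasurableSpace X] {μ : Measure X} {q : ℝ}

/-- Hölder with weights `(q - 2)/q`, `1/q`, `1/q`. Working with weights instead of conjugate
exponents includes `q = 2`, where the first weight is `0`. -/
theorem lintegral_rpow_mul_mul_le (hq : 2 ≤ q) {f g h : X → ℝ}
    (hf : AEStronglyMeasurable f μ) (hg : AEStronglyMeasurable g μ)
    (hh : AEStronglyMeasurable h μ) :
    ∫⁻ x, ‖f x‖ₑ ^ (q - 2) * ‖g x‖ₑ * ‖h x‖ₑ ∂μ ≤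
      eLpNorm f (ENNReal.ofReal q) μ ^ (q - 2) * eLpNorm g (ENNReal.ofReal q) μ *
        eLpNorm h (ENNReal.ofReal q) μ := by
  have hq0 : 0 < q := by linarith
  have key := ENNReal.lintegral_prod_norm_pow_le (μ := μ) (Finset.univ : Finset (Fin 3))
    (f := ![fun x => ‖f x‖ₑ ^ q, fun x => ‖g x‖ₑ ^ q, fun x => ‖h x‖ₑ ^ q])
    (p := ![(q - 2) / q, 1 / q, 1 / q])
    (by
      intro i _
      fin_cases i
      · exact hf.enorm.pow_const q
      · exact hg.enorm.pow_const q
      · exact hh.enorm.pow_const q)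
    (by simp [Fin.sum_univ_three]; field_simp; ring)
    (by
      intro i _
      fin_cases i
      · exact div_nonneg (by linarith) hq0.le
      · simpa using hq0.le
      · simpa using hq0.le)
  have e1 : ∀ t : ℝ≥0∞, (t ^ q) ^ (1 / q) = t := fun t => by
    rw [← ENNReal.rpow_mul, mul_one_div_cancel hq0.ne', ENNReal.rpow_one]
  have e2 : ∀ t : ℝ≥0∞, (t ^ q) ^ ((q - 2) / q) = t ^ (q - 2) := fun t => by
    rw [← ENNReal.rpow_mul, mul_div_cancel₀ _ hq0.ne']
  have e3 : ∀ t : ℝ≥0∞, t ^ ((q - 2) / q) = (t ^ (1 / q)) ^ (q - 2) := fun t => by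
    rw [← ENNReal.rpow_mul]; congr 1; ring
  simp only [Fin.prod_univ_three, Matrix.cons_val_zero, Matrix.cons_val_one, Matrix.cons_val,
    e1, e2] at key
  rw [e3] at key
  simpa only [eLpNorm_eq_lintegral_rpow_enorm_toReal (by simpa using hq0 : ENNReal.ofReal q ≠ 0)
    ENNReal.ofReal_ne_top, ENNReal.toReal_ofReal hq0.le] using key

theorem enorm_abs_rpow_mul_mul (hq : 2 ≤ q) (x y z : ℝ) :
    ‖|x| ^ (q - 2) * |y| * |z|‖ₑ = ‖x‖ₑ ^ (q - 2) * ‖y‖ₑ * ‖z‖ₑ := by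
  rw [enorm_mul, enorm_mul, Real.enorm_rpow_of_nonneg (abs_nonneg x) (by linarith)]
  simp only [Real.enorm_abs]

theorem integrable_abs_rpow_mul_mul (hq : 2 ≤ q) {f g h : X → ℝ}
    (hf : MemLp f (ENNReal.ofReal q) μ) (hg : MemLp g (ENNReal.ofReal q) μ)
    (hh : MemLp h (ENNReal.ofReal q) μ) :
    Integrable (fun x => |f x| ^ (q - 2) * |g x| * |h x|) μ := by
  refine ⟨?_, ?_⟩
  · exact (((hf.1.aemeasurable.norm.pow_const (q - 2)).mul hg.1.aemeasurable.norm).mul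
      hh.1.aemeasurable.norm).aestronglyMeasurable
  · rw [HasFiniteIntegral]
    simp only [enorm_abs_rpow_mul_mul hq]
    refine (lintegral_rpow_mul_mul_le hq hf.1 hg.1 hh.1).trans_lt ?_
    exact ENNReal.mul_lt_top (ENNReal.mul_lt_top
      (ENNReal.rpow_lt_top_of_nonneg (by linarith) hf.2.ne) hg.2) hh.2

theorem integral_abs_rpow_mul_mul_le (hq : 2 ≤ q) (f g h : Lp ℝ (ENNReal.ofReal q) μ) :
    ∫ x, |f x| ^ (q - 2) * |g x| * |h x| ∂μ ≤ ‖f‖ ^ (q - 2) * ‖g‖ * ‖h‖ := by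
  rw [Lp.norm_def, Lp.norm_def, Lp.norm_def, ENNReal.toReal_rpow, ← ENNReal.toReal_mul,
    ← ENNReal.toReal_mul, integral_eq_lintegral_of_nonneg_ae
      (Eventually.of_forall fun x => by simp only [Pi.zero_apply]; positivity)
      (integrable_abs_rpow_mul_mul hq (Lp.memLp f) (Lp.memLp g) (Lp.memLp h)).1]
  refine ENNReal.toReal_mono ?_ ?_
  · exact ENNReal.mul_ne_top (ENNReal.mul_ne_top
      (ENNReal.rpow_ne_top_of_nonneg (by linarith) (Lp.eLpNorm_ne_top f)) (Lp.eLpNorm_ne_top g))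
      (Lp.eLpNorm_ne_top h)
  · refine le_trans (le_of_eq (lintegral_congr fun x => ?_))
      (lintegral_rpow_mul_mul_le hq (Lp.aestronglyMeasurable f) (Lp.aestronglyMeasurable g)
        (Lp.aestronglyMeasurable h))
    rw [← enorm_abs_rpow_mul_mul hq, Real.enorm_eq_ofReal (by positivity)]

theorem integral_abs_rpow_eq_norm_rpow (hq : 0 < q) (f : Lp ℝ (ENNReal.ofReal q) μ) :
    ∫ x, |f x| ^ q ∂μ = ‖f‖ ^ q := by
  have h := (Lp.memLp f).eLpNorm_eq_integral_rpow_norm (by simpa using hq) ENNReal.ofReal_ne_top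
  rw [ENNReal.toReal_ofReal hq.le] at h
  rw [Lp.norm_def, h, ENNReal.toReal_ofReal (by positivity), ← Real.rpow_mul (by positivity),
    inv_mul_cancel₀ hq.ne', Real.rpow_one]
  rfl

end Holder

/-! ### Integral functionals of class `C^1` on `L^q` -/

namespace HasPowerLipschitzDeriv

variable {X : Type*} [MeasurableSpace X] {μ : Measure X} {q C C₀ : ℝ} {φ ψ : ℝ → ℝ}

/-- The constant function `c` acts on `L^q(μ)` as a bounded functional of norm at most `C₀`. -/
def ConstBounded (μ : Measure X) (q c C₀ : ℝ) : Prop :=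
  ∀ h : Lp ℝ (ENNReal.ofReal q) μ,
    Integrable (fun x => c * h x) μ ∧ |∫ x, c * h x ∂μ| ≤ C₀ * ‖h‖

theorem integrable_sub_mul (H : HasPowerLipschitzDeriv q C φ ψ)
    (f g h : Lp ℝ (ENNReal.ofReal q) μ) :
    Integrable (fun x => (ψ (f x) - ψ (g x)) * h x) μ := by
  have h0 := (integrable_abs_rpow_mul_mul H.two_le
    ((Lp.memLp f).abs.add (Lp.memLp g).abs) ((Lp.memLp f).sub (Lp.memLp g))
    (Lp.memLp h)).const_mul C
  refine h0.mono' ?_ (Eventually.of_forall fun x => ?_)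
  · exact ((H.continuous_deriv.comp_aestronglyMeasurable (Lp.aestronglyMeasurable f)).sub
      (H.continuous_deriv.comp_aestronglyMeasurable (Lp.aestronglyMeasurable g))).mul
      (Lp.aestronglyMeasurable h)
  · rw [Real.norm_eq_abs, abs_mul]
    calc _ ≤ C * ((|f x| + |g x|) ^ (q - 2) * |f x - g x|) * |h x| :=
        mul_le_mul_of_nonneg_right (H.abs_sub_le _ _) (abs_nonneg _)
      _ = _ := by
        simp only [Pi.add_apply, Pi.sub_apply, Pi.abs_apply]
        rw [abs_of_nonneg (by positivity : 0 ≤ |f x| + |g x|)]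
        ring

theorem abs_integral_sub_mul_le [Fact (1 ≤ ENNReal.ofReal q)]
    (H : HasPowerLipschitzDeriv q C φ ψ) (f g h : Lp ℝ (ENNReal.ofReal q) μ) :
    |∫ x, (ψ (f x) - ψ (g x)) * h x ∂μ| ≤
      C * ((‖f‖ + ‖g‖) ^ (q - 2) * ‖f - g‖) * ‖h‖ := by
  have hq : 0 ≤ q - 2 := by linarith [H.two_le]
  set w : Lp ℝ (ENNReal.ofReal q) μ := |f| + |g|
  have hw : ‖w‖ ≤ ‖f‖ + ‖g‖ := by
    refine (norm_add_le _ _).trans ?_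
    rw [norm_abs_eq_norm, norm_abs_eq_norm]
  have h0 := (integrable_abs_rpow_mul_mul H.two_le (Lp.memLp w) (Lp.memLp (f - g))
    (Lp.memLp h)).const_mul C
  have h1 : ‖∫ x, (ψ (f x) - ψ (g x)) * h x ∂μ‖ ≤
      ∫ x, C * (|w x| ^ (q - 2) * |(f - g : Lp ℝ (ENNReal.ofReal q) μ) x| * |h x|) ∂μ := by
    refine norm_integral_le_of_norm_le h0 ?_
    filter_upwards [Lp.coeFn_add |f| |g|, Lp.coeFn_abs f, Lp.coeFn_abs g, Lp.coeFn_sub f g]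
      with x hx1 hx2 hx3 hx4
    have hwx : w x = |f x| + |g x| := by
      rw [hx1, Pi.add_apply, hx2, hx3]
    rw [hwx, hx4, Pi.sub_apply, abs_of_nonneg (by positivity : 0 ≤ |f x| + |g x|),
      Real.norm_eq_abs, abs_mul]
    calc _ ≤ C * ((|f x| + |g x|) ^ (q - 2) * |f x - g x|) * |h x| :=
        mul_le_mul_of_nonneg_right (H.abs_sub_le _ _) (abs_nonneg _)
      _ = _ := by ring
  rw [integral_const_mul] at h1
  refine h1.trans ?_
  rw [mul_assoc C]
  refine mul_le_mul_of_nonneg_left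
    ((integral_abs_rpow_mul_mul_le H.two_le w (f - g) h).trans ?_) H.nonneg
  gcongr

/-- The Lipschitz estimate controls only `ψ(f) - ψ(0)`. On an infinite measure the constant `ψ 0`
need not pair with `L^q`, hence `ConstBounded`: it is trivial for `|t|^p`, where `ψ 0 = 0`, and
holds for the kernel because `a dx` is finite. -/
theorem integrable_deriv_mul (H : HasPowerLipschitzDeriv q C φ ψ)
    (hc : ConstBounded μ q (ψ 0) C₀) (f h : Lp ℝ (ENNReal.ofReal q) μ) :
    Integrable (fun x => ψ (f x) * h x) μ := by
  have h1 := (H.integrable_sub_mul f 0 h).add (hc h).1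
  refine h1.congr ?_
  filter_upwards [Lp.coeFn_zero ℝ (ENNReal.ofReal q) μ] with x hx
  simp only [Pi.add_apply, hx, Pi.zero_apply]
  ring

theorem integrable_comp (H : HasPowerLipschitzDeriv q C φ ψ)
    (hc : ConstBounded μ q (ψ 0) C₀) (f : Lp ℝ (ENNReal.ofReal q) μ) :
    Integrable (fun x => φ (f x)) μ := by
  have h1 : Integrable (fun x => φ (f x) - ψ 0 * f x) μ := by
    refine ((integrable_abs_rpow_mul_mul H.two_le (Lp.memLp f) (Lp.memLp f)
      (Lp.memLp f)).const_mul C).mono' ?_ (Eventually.of_forall fun x => H.abs_sub_linear_le _)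
    exact (H.continuous.comp_aestronglyMeasurable (Lp.aestronglyMeasurable f)).sub
      ((Lp.aestronglyMeasurable f).const_mul _)
  refine (h1.add (hc f).1).congr (Eventually.of_forall fun x => ?_)
  simp

/-- The derivative `h ↦ ∫ ψ(f) h` of the functional `f ↦ ∫ φ(f)` on `L^q(μ)`. -/
def integralDeriv [Fact (1 ≤ ENNReal.ofReal q)] (H : HasPowerLipschitzDeriv q C φ ψ)
    (hc : ConstBounded μ q (ψ 0) C₀) (f : Lp ℝ (ENNReal.ofReal q) μ) :
    Lp ℝ (ENNReal.ofReal q) μ →L[ℝ] ℝ :=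
  LinearMap.mkContinuous
    { toFun := fun h => ∫ x, ψ (f x) * h x ∂μ
      map_add' := fun g h => by
        rw [← integral_add (H.integrable_deriv_mul hc f g) (H.integrable_deriv_mul hc f h)]
        refine integral_congr_ae ?_
        filter_upwards [Lp.coeFn_add g h] with x hx
        rw [hx, Pi.add_apply]
        ring
      map_smul' := fun c h => by
        rw [RingHom.id_apply, smul_eq_mul, ← integral_const_mul]
        refine integral_congr_ae ?_
        filter_upwards [Lp.coeFn_smul c h] with x hx
        rw [hx, Pi.smul_apply, smul_eq_mul]
        ring }
    (C * (‖f‖ ^ (q - 2) * ‖f‖) + C₀)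
    (fun h => by
      have h1 : ∫ x, ψ (f x) * h x ∂μ = ∫ x, (ψ (f x) -
          ψ ((0 : Lp ℝ (ENNReal.ofReal q) μ) x)) * h x ∂μ + ∫ x, ψ 0 * h x ∂μ := by
        rw [← integral_add (H.integrable_sub_mul f 0 h) (hc h).1]
        refine integral_congr_ae ?_
        filter_upwards [Lp.coeFn_zero ℝ (ENNReal.ofReal q) μ] with x hx
        rw [hx, Pi.zero_apply]
        ring
      have h2 := H.abs_integral_sub_mul_le f 0 h
      rw [norm_zero, add_zero, sub_zero] at h2
      simp only [LinearMap.coe_mk, AddHom.coe_mk]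
      rw [h1, add_mul]
      exact (norm_add_le _ _).trans (add_le_add h2 (hc h).2))

theorem integralDeriv_apply [Fact (1 ≤ ENNReal.ofReal q)] (H : HasPowerLipschitzDeriv q C φ ψ)
    (hc : ConstBounded μ q (ψ 0) C₀) (f h : Lp ℝ (ENNReal.ofReal q) μ) :
    H.integralDeriv hc f h = ∫ x, ψ (f x) * h x ∂μ := rfl

theorem continuous_integralDeriv [Fact (1 ≤ ENNReal.ofReal q)]
    (H : HasPowerLipschitzDeriv q C φ ψ) (hc : ConstBounded μ q (ψ 0) C₀) :
    Continuous (H.integralDeriv hc) := by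
  have hq : 0 ≤ q - 2 := by linarith [H.two_le]
  have hC := H.nonneg
  refine continuous_iff_continuousAt.2 fun f => ?_
  rw [ContinuousAt, tendsto_iff_norm_sub_tendsto_zero]
  have h1 : Tendsto (fun g : Lp ℝ (ENNReal.ofReal q) μ =>
      C * ((‖g‖ + ‖f‖) ^ (q - 2) * ‖g - f‖)) (𝓝 f) (𝓝 0) := by
    have : Continuous fun g : Lp ℝ (ENNReal.ofReal q) μ =>
        C * ((‖g‖ + ‖f‖) ^ (q - 2) * ‖g - f‖) :=
      continuous_const.mul (((by fun_prop : Continuous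
        fun g : Lp ℝ (ENNReal.ofReal q) μ => ‖g‖ + ‖f‖).rpow_const
        fun _ => Or.inr hq).mul (by fun_prop))
    simpa using this.tendsto f
  refine squeeze_zero (fun _ => norm_nonneg _) (fun g => ?_) h1
  refine ContinuousLinearMap.opNorm_le_bound _ (by positivity) fun h => ?_
  refine le_trans (le_of_eq ?_) (H.abs_integral_sub_mul_le g f h)
  rw [sub_apply, integralDeriv_apply, integralDeriv_apply,
    ← integral_sub (H.integrable_deriv_mul hc g h) (H.integrable_deriv_mul hc f h),
    Real.norm_eq_abs]
  simp only [sub_mul]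

/-- Integrating the Taylor remainder with Hölder gives an error of at most `C (2‖f‖ + ‖h‖)^(q-2)
‖h‖²`, which is `o(‖h‖)`. -/
theorem hasFDerivAt_integral [Fact (1 ≤ ENNReal.ofReal q)]
    (H : HasPowerLipschitzDeriv q C φ ψ) (hc : ConstBounded μ q (ψ 0) C₀)
    (f : Lp ℝ (ENNReal.ofReal q) μ) :
    HasFDerivAt (fun g : Lp ℝ (ENNReal.ofReal q) μ => ∫ x, φ (g x) ∂μ)
      (H.integralDeriv hc f) f := by
  have hq : 0 ≤ q - 2 := by linarith [H.two_le]
  rw [hasFDerivAt_iff_isLittleO_nhds_zero]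
  have key : ∀ h : Lp ℝ (ENNReal.ofReal q) μ,
      ‖∫ x, φ ((f + h : Lp ℝ (ENNReal.ofReal q) μ) x) ∂μ - ∫ x, φ (f x) ∂μ -
        H.integralDeriv hc f h‖ ≤ C * ((2 * ‖f‖ + ‖h‖) ^ (q - 2) * ‖h‖) * ‖h‖ := by
    intro h
    -- The weight of the Taylor remainder, taken as an element of `L^q` so that the triangle
    -- inequality bounds its norm.
    set w : Lp ℝ (ENNReal.ofReal q) μ := (2 : ℝ) • |f| + |h|
    have hw : ‖w‖ ≤ 2 * ‖f‖ + ‖h‖ := by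
      refine (norm_add_le _ _).trans ?_
      rw [norm_smul, norm_abs_eq_norm, norm_abs_eq_norm]
      simp
    have h0 := (integrable_abs_rpow_mul_mul H.two_le (Lp.memLp w) (Lp.memLp h)
      (Lp.memLp h)).const_mul C
    rw [integralDeriv_apply, ← integral_sub (H.integrable_comp hc _) (H.integrable_comp hc _),
      ← integral_sub (f := fun x => φ ((f + h : Lp ℝ (ENNReal.ofReal q) μ) x) - φ (f x))
        ((H.integrable_comp hc _).sub (H.integrable_comp hc _)) (H.integrable_deriv_mul hc f h)]
    have h1 : ‖∫ x, (φ ((f + h : Lp ℝ (ENNReal.ofReal q) μ) x) - φ (f x) - ψ (f x) * h x) ∂μ‖ ≤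
        ∫ x, C * (|w x| ^ (q - 2) * |h x| * |h x|) ∂μ := by
      refine norm_integral_le_of_norm_le h0 ?_
      filter_upwards [Lp.coeFn_add ((2 : ℝ) • |f|) |h|, Lp.coeFn_smul (2 : ℝ) |f|,
        Lp.coeFn_abs f, Lp.coeFn_abs h, Lp.coeFn_add f h] with x hx1 hx2 hx3 hx4 hx5
      have hwx : w x = 2 * |f x| + |h x| := by
        rw [hx1, Pi.add_apply, hx2, Pi.smul_apply, hx3, hx4, smul_eq_mul]
      rw [hwx, hx5, Pi.add_apply, abs_of_nonneg (by positivity : 0 ≤ 2 * |f x| + |h x|)]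
      exact H.abs_taylor_le _ _
    rw [integral_const_mul] at h1
    refine h1.trans ?_
    rw [mul_assoc C]
    refine mul_le_mul_of_nonneg_left
      ((integral_abs_rpow_mul_mul_le H.two_le w h h).trans ?_) H.nonneg
    gcongr
  have h1 : Tendsto (fun h : Lp ℝ (ENNReal.ofReal q) μ =>
      C * ((2 * ‖f‖ + ‖h‖) ^ (q - 2) * ‖h‖)) (𝓝 0) (𝓝 0) := by
    have : Continuous fun h : Lp ℝ (ENNReal.ofReal q) μ =>
        C * ((2 * ‖f‖ + ‖h‖) ^ (q - 2) * ‖h‖) :=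
      continuous_const.mul (((by fun_prop : Continuous
        fun h : Lp ℝ (ENNReal.ofReal q) μ => 2 * ‖f‖ + ‖h‖).rpow_const
        fun _ => Or.inr hq).mul (by fun_prop))
    simpa using this.tendsto 0
  refine Asymptotics.isLittleO_iff.2 fun c hcpos => ?_
  filter_upwards [h1.eventually (ge_mem_nhds hcpos)] with h hh
  exact (key h).trans (mul_le_mul_of_nonneg_right hh (norm_nonneg _))

theorem contDiff_integral [Fact (1 ≤ ENNReal.ofReal q)]
    (H : HasPowerLipschitzDeriv q C φ ψ) (hc : ConstBounded μ q (ψ 0) C₀) :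
    ContDiff ℝ 1 (fun g : Lp ℝ (ENNReal.ofReal q) μ => ∫ x, φ (g x) ∂μ) :=
  contDiff_one_iff_hasFDerivAt.2
    ⟨_, H.continuous_integralDeriv hc, H.hasFDerivAt_integral hc⟩

end HasPowerLipschitzDeriv

/-! ### The fractional Sobolev inequality -/

theorem rpow_add_le_of_forall_le_of_pos {x A B a b : ℝ} (hx : 0 ≤ x) (hA : 0 < A) (hB : 0 < B)
    (ha : 0 < a) (hb : 0 < b) (h : ∀ r : ℝ, 0 < r → x ≤ A * r ^ a + B * r ^ (-b)) :
    x ^ (a + b) ≤ 2 ^ (a + b) * (A ^ b * B ^ a) := by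
  have hab : 0 < a + b := by linarith
  have hBA : 0 < B / A := div_pos hB hA
  -- This radius makes the two terms equal.
  have h1 := h ((B / A) ^ (1 / (a + b))) (Real.rpow_pos_of_pos hBA _)
  rw [← Real.rpow_mul hBA.le, ← Real.rpow_mul hBA.le] at h1
  have h2 : B * (B / A) ^ (1 / (a + b) * -b) = A * (B / A) ^ (1 / (a + b) * a) := by
    have e : 1 / (a + b) * a = 1 + 1 / (a + b) * -b := by field_simp; ring
    rw [e, Real.rpow_add hBA, Real.rpow_one]
    field_simp
  rw [h2, ← two_mul] at h1
  refine (Real.rpow_le_rpow hx h1 hab.le).trans (le_of_eq ?_)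
  rw [Real.mul_rpow zero_le_two (by positivity), Real.mul_rpow hA.le (by positivity),
    ← Real.rpow_mul hBA.le]
  have e : 1 / (a + b) * a * (a + b) = a := by field_simp
  rw [e, Real.div_rpow hB.le hA.le, Real.rpow_add hA]
  have := (Real.rpow_pos_of_pos hA a).ne'
  field_simp

/-- Optimisation of `x ≤ A r^a + B r^{-b}` in `r`. -/
theorem rpow_add_le_of_forall_le {x A B a b : ℝ} (hx : 0 ≤ x) (hA : 0 ≤ A) (hB : 0 ≤ B)
    (ha : 0 < a) (hb : 0 < b) (h : ∀ r : ℝ, 0 < r → x ≤ A * r ^ a + B * r ^ (-b)) :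
    x ^ (a + b) ≤ 2 ^ (a + b) * (A ^ b * B ^ a) := by
  -- The balancing radius is unavailable if `A` or `B` vanishes; both are perturbed by `ε`, and then
  -- `ε → 0`.
  have h1 : ∀ ε : ℝ, 0 < ε → x ^ (a + b) ≤ 2 ^ (a + b) * ((A + ε) ^ b * (B + ε) ^ a) := by
    intro ε hε
    refine rpow_add_le_of_forall_le_of_pos hx (by linarith) (by linarith) ha hb fun r hr => ?_
    refine (h r hr).trans ?_
    have := Real.rpow_pos_of_pos hr a
    have := Real.rpow_pos_of_pos hr (-b)
    gcongr <;> linarith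
  have h2 : Continuous fun ε : ℝ => 2 ^ (a + b) * ((A + ε) ^ b * (B + ε) ^ a) :=
    continuous_const.mul
      (((continuous_const.add continuous_id).rpow_const fun _ => Or.inr hb.le).mul
        ((continuous_const.add continuous_id).rpow_const fun _ => Or.inr ha.le))
  have h3 := (h2.tendsto 0).mono_left (nhdsWithin_le_nhds (s := Set.Ioi 0))
  simp only [add_zero] at h3
  exact ge_of_tendsto h3 (eventually_nhdsWithin_of_forall h1)

section Sobolev

variable {N : ℕ} {s p : ℝ}

/-- The inner integral `∫ |u(x) - u(y)|^p / |x - y|^{N + sp} dy` of the Gagliardo seminorm. -/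
def gagliardoFiber (s p : ℝ) (u : RN N → ℝ) (x : RN N) : ℝ≥0∞ :=
  ∫⁻ y, ENNReal.ofReal (|u x - u y| ^ p / ‖x - y‖ ^ ((N : ℝ) + s * p))

theorem enorm_sub_rpow_le (hp : 0 < p) (hm : 0 ≤ (N : ℝ) + s * p) (u : RN N → ℝ) {x y : RN N}
    {r : ℝ} (hr : 0 < r) (hy : y ∈ Metric.ball x r) :
    ‖u x - u y‖ₑ ^ p ≤ ENNReal.ofReal (r ^ ((N : ℝ) + s * p)) *
      ENNReal.ofReal (|u x - u y| ^ p / ‖x - y‖ ^ ((N : ℝ) + s * p)) := by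
  rw [Real.enorm_eq_ofReal_abs, ENNReal.ofReal_rpow_of_nonneg (abs_nonneg _) hp.le,
    ← ENNReal.ofReal_mul (by positivity)]
  refine ENNReal.ofReal_le_ofReal ?_
  by_cases hxy : x = y
  · subst hxy
    simp [Real.zero_rpow hp.ne']
  · have h1 : 0 < ‖x - y‖ := norm_pos_iff.2 (sub_ne_zero.2 hxy)
    have h2 : ‖x - y‖ ≤ r := by
      rw [← dist_eq_norm, dist_comm]
      exact (Metric.mem_ball.1 hy).le
    have h3 := Real.rpow_pos_of_pos h1 ((N : ℝ) + s * p)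
    rw [← mul_div_assoc, le_div_iff₀ h3, mul_comm]
    exact mul_le_mul_of_nonneg_right (Real.rpow_le_rpow h1.le h2 hm) (by positivity)

theorem setLIntegral_enorm_rpow_le {q : ℝ} (hp : 0 < p) (hpq : p ≤ q) {u : RN N → ℝ}
    (hu : AEStronglyMeasurable u volume) (B : Set (RN N)) :
    ∫⁻ y in B, ‖u y‖ₑ ^ p ≤
      eLpNorm u (ENNReal.ofReal q) volume ^ p * volume B ^ (1 - p / q) := by
  have hq : 0 < q := hp.trans_le hpq
  have h1 := eLpNorm_le_eLpNorm_mul_rpow_measure_univ (ENNReal.ofReal_le_ofReal hpq)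
    (hu.restrict (s := B))
  rw [ENNReal.toReal_ofReal hp.le, ENNReal.toReal_ofReal hq.le, Measure.restrict_apply_univ] at h1
  have h2 := h1.trans (mul_le_mul_left
    (eLpNorm_mono_measure u (Measure.restrict_le_self (μ := volume) (s := B))) _)
  have h3 := ENNReal.rpow_le_rpow h2 hp.le
  rw [eLpNorm_eq_lintegral_rpow_enorm_toReal (by simpa using hp) ENNReal.ofReal_ne_top,
    ENNReal.toReal_ofReal hp.le, ← ENNReal.rpow_mul, one_div_mul_cancel hp.ne',
    ENNReal.rpow_one, ENNReal.mul_rpow_of_nonneg _ _ hp.le, ← ENNReal.rpow_mul] at h3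
  convert! h3 using 3
  field_simp

/-- Integrate `|u x|^p ≤ 2^(p-1) (|u x - u y|^p + |u y|^p)` over `y` in the ball. There `‖x - y‖ ≤
r`, so the first term is controlled by the Gagliardo fibre at `x`; the second is handled by Hölder.
-/
theorem enorm_rpow_mul_volume_ball_le [h : Admissible N s p] {q : ℝ} (hpq : p ≤ q)
    {u : RN N → ℝ} (hu : AEStronglyMeasurable u volume) (x : RN N) {r : ℝ} (hr : 0 < r) :
    ‖u x‖ₑ ^ p * volume (Metric.ball x r) ≤ 2 ^ (p - 1) *
      (ENNReal.ofReal (r ^ ((N : ℝ) + s * p)) * gagliardoFiber s p u x +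
        eLpNorm u (ENNReal.ofReal q) volume ^ p * volume (Metric.ball x r) ^ (1 - p / q)) := by
  have hp : 0 < p := Admissible.p_pos (N := N) (s := s)
  have hp1 : 1 ≤ p := by linarith [h.two_le]
  have hm : 0 ≤ (N : ℝ) + s * p := by have := h.s_pos; positivity
  rw [← setLIntegral_const]
  calc ∫⁻ _ in Metric.ball x r, ‖u x‖ₑ ^ p
      ≤ ∫⁻ y in Metric.ball x r, 2 ^ (p - 1) * (‖u x - u y‖ₑ ^ p + ‖u y‖ₑ ^ p) := by
        refine lintegral_mono fun y => ?_
        refine le_trans (ENNReal.rpow_le_rpow ?_ hp.le)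
          (ENNReal.rpow_add_le_mul_rpow_add_rpow _ _ hp1)
        simpa using enorm_add_le (u x - u y) (u y)
    _ = 2 ^ (p - 1) * ((∫⁻ y in Metric.ball x r, ‖u x - u y‖ₑ ^ p) +
          ∫⁻ y in Metric.ball x r, ‖u y‖ₑ ^ p) := by
        rw [lintegral_const_mul' _ _ (ENNReal.rpow_ne_top_of_nonneg (by linarith) (by simp)),
          lintegral_add_right' _ (hu.restrict.enorm.pow_const p)]
    _ ≤ _ := by
        refine mul_le_mul_right (add_le_add ?_ (setLIntegral_enorm_rpow_le hp hpq hu _)) _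
        calc _ ≤ ∫⁻ y in Metric.ball x r, ENNReal.ofReal (r ^ ((N : ℝ) + s * p)) *
              ENNReal.ofReal (|u x - u y| ^ p / ‖x - y‖ ^ ((N : ℝ) + s * p)) :=
              setLIntegral_mono' measurableSet_ball fun y hy => enorm_sub_rpow_le hp hm u hr hy
          _ ≤ ∫⁻ y, ENNReal.ofReal (r ^ ((N : ℝ) + s * p)) *
              ENNReal.ofReal (|u x - u y| ^ p / ‖x - y‖ ^ ((N : ℝ) + s * p)) :=
              setLIntegral_le_lintegral _ _
          _ = _ := lintegral_const_mul' _ _ ENNReal.ofReal_ne_top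

theorem Admissible.mul_lt [h : Admissible N s p] : s * p < N := by
  have := (lt_div_iff₀ h.s_pos).1 h.lt_div
  linarith

theorem Admissible.mul_pos [h : Admissible N s p] : 0 < s * p :=
  _root_.mul_pos h.s_pos (Admissible.p_pos (N := N) (s := s))

theorem Admissible.lt_critExp [h : Admissible N s p] : p < critExp N s p := by
  have h1 := Admissible.mul_lt (N := N) (s := s) (p := p)
  have h2 := Admissible.mul_pos (N := N) (s := s) (p := p)
  have h3 : 0 < p := Admissible.p_pos (N := N) (s := s)
  rw [critExp, lt_div_iff₀ (by linarith)]
  nlinarith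

theorem Admissible.one_sub_div_critExp [h : Admissible N s p] :
    1 - p / critExp N s p = s * p / N := by
  have h1 := Admissible.mul_lt (N := N) (s := s) (p := p)
  have h2 := Admissible.mul_pos (N := N) (s := s) (p := p)
  have h3 : 0 < p := Admissible.p_pos (N := N) (s := s)
  have h4 : (N : ℝ) ≠ 0 := by linarith
  have h5 : (N : ℝ) - s * p ≠ 0 := by linarith
  rw [critExp]
  field_simp
  ring

/-- The previous estimate with `q = p^*`, divided by the volume `ω r^N` of the ball. The two powers
of `r` have opposite signs, so the radius can be optimized at each point. -/
theorem abs_rpow_le_of_gagliardoFiber [h : Admissible N s p] {u : RN N → ℝ}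
    (hu : MemLp u (ENNReal.ofReal (critExp N s p)) volume) {x : RN N}
    (hx : gagliardoFiber s p u x ≠ ∞) {r : ℝ} (hr : 0 < r) :
    |u x| ^ p ≤ (2 ^ (p - 1) / (volume (Metric.ball (0 : RN N) 1)).toReal *
        (gagliardoFiber s p u x).toReal) * r ^ (s * p) +
      (2 ^ (p - 1) * (volume (Metric.ball (0 : RN N) 1)).toReal ^ (s * p / N - 1) *
        (eLpNorm u (ENNReal.ofReal (critExp N s p)) volume).toReal ^ p) *
        r ^ (-(N - s * p)) := by
  have hp : 0 < p := Admissible.p_pos (N := N) (s := s)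
  have hp1 : 1 ≤ p := by linarith [h.two_le]
  have hN : (0 : ℝ) < N := by
    linarith [Admissible.mul_lt (N := N) (s := s) (p := p),
      Admissible.mul_pos (N := N) (s := s) (p := p)]
  have hsp := Admissible.mul_pos (N := N) (s := s) (p := p)
  have key := enorm_rpow_mul_volume_ball_le (s := s)
    (Admissible.lt_critExp (N := N) (s := s) (p := p)).le hu.1 x hr
  rw [Admissible.one_sub_div_critExp, Measure.addHaar_ball_of_pos volume x hr,
    finrank_euclideanSpace_fin] at key
  set ω := volume (Metric.ball (0 : RN N) 1)
  have hω : ω ≠ ∞ := measure_ball_lt_top.ne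
  have hω0 : 0 < ω.toReal := ENNReal.toReal_pos (Metric.measure_ball_pos _ _ one_pos).ne' hω
  have key2 := ENNReal.toReal_mono ?_ key
  swap
  · refine ENNReal.mul_ne_top (ENNReal.rpow_ne_top_of_nonneg (by linarith) (by simp))
      (ENNReal.add_ne_top.2 ⟨ENNReal.mul_ne_top ENNReal.ofReal_ne_top hx, ENNReal.mul_ne_top
        (ENNReal.rpow_ne_top_of_nonneg hp.le hu.2.ne)
        (ENNReal.rpow_ne_top_of_nonneg (by positivity)
          (ENNReal.mul_ne_top ENNReal.ofReal_ne_top hω))⟩)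
  rw [ENNReal.toReal_mul, ENNReal.toReal_mul (a := (2 : ℝ≥0∞) ^ (p - 1)), ENNReal.toReal_add
      (ENNReal.mul_ne_top ENNReal.ofReal_ne_top hx) (ENNReal.mul_ne_top
        (ENNReal.rpow_ne_top_of_nonneg hp.le hu.2.ne)
        (ENNReal.rpow_ne_top_of_nonneg (by positivity)
          (ENNReal.mul_ne_top ENNReal.ofReal_ne_top hω)))] at key2
  simp only [ENNReal.toReal_mul, ← ENNReal.toReal_rpow, toReal_enorm, Real.norm_eq_abs,
    ENNReal.toReal_ofReal (by positivity : 0 ≤ r ^ N),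
    ENNReal.toReal_ofReal (by positivity : 0 ≤ r ^ ((N : ℝ) + s * p)),
    ENNReal.toReal_ofNat] at key2
  set G := (gagliardoFiber s p u x).toReal
  set U := (eLpNorm u (ENNReal.ofReal (critExp N s p)) volume).toReal
  have hrN : 0 < r ^ N := by positivity
  have e1 : (r ^ N * ω.toReal) ^ (s * p / N) = r ^ (s * p) * ω.toReal ^ (s * p / N) := by
    rw [Real.mul_rpow hrN.le hω0.le, ← Real.rpow_natCast, ← Real.rpow_mul hr.le,
      mul_div_cancel₀ _ hN.ne']
  rw [e1, Real.rpow_add hr, Real.rpow_natCast] at key2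
  rw [← mul_le_mul_iff_left₀ (mul_pos hrN hω0)]
  refine key2.trans (le_of_eq ?_)
  have e2 : r ^ (-(N - s * p)) = r ^ (s * p) / r ^ N := by
    rw [← Real.rpow_natCast, ← Real.rpow_sub hr]
    congr 1
    ring
  rw [e2, Real.rpow_sub_one hω0.ne']
  field_simp

theorem lintegral_gagliardoFiber (hp : 0 < p) {u : RN N → ℝ}
    (hu : AEStronglyMeasurable u volume) :
    ∫⁻ x, gagliardoFiber s p u x = gagliardo s p u ^ p ∧
      AEMeasurable (gagliardoFiber s p u) volume := by
  have hm : AEMeasurable (fun z : RN N × RN N =>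
      ENNReal.ofReal (|u z.1 - u z.2| ^ p / ‖z.1 - z.2‖ ^ ((N : ℝ) + s * p)))
      ((volume : Measure (RN N)).prod volume) := by
    have h1 := hu.comp_quasiMeasurePreserving (Measure.quasiMeasurePreserving_fst
      (μ := (volume : Measure (RN N))) (ν := (volume : Measure (RN N))))
    have h2 := hu.comp_quasiMeasurePreserving (Measure.quasiMeasurePreserving_snd
      (μ := (volume : Measure (RN N))) (ν := (volume : Measure (RN N))))
    have h3 : Measurable fun z : RN N × RN N => ‖z.1 - z.2‖ ^ ((N : ℝ) + s * p) := by
      fun_prop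
    exact (((h1.sub h2).aemeasurable.norm.pow_const p).div h3.aemeasurable).ennreal_ofReal
  refine ⟨?_, hm.lintegral_prod_right'⟩
  rw [gagliardo, ← ENNReal.rpow_mul, one_div_mul_cancel hp.ne', ENNReal.rpow_one,
    Measure.volume_eq_prod, lintegral_prod _ hm]
  rfl

/-- The fractional Sobolev inequality. -/
theorem exists_eLpNorm_critExp_le_gagliardo (N : ℕ) (s p : ℝ) [h : Admissible N s p] :
    ∃ C : ℝ, 0 ≤ C ∧ ∀ u : RN N → ℝ, MemLp u (ENNReal.ofReal (critExp N s p)) volume →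
      gagliardo s p u < ∞ →
      (eLpNorm u (ENNReal.ofReal (critExp N s p)) volume).toReal ≤
        C * (gagliardo s p u).toReal := by
  have hp : 0 < p := Admissible.p_pos (N := N) (s := s)
  have hsp := Admissible.mul_pos (N := N) (s := s) (p := p)
  have hd : 0 < (N : ℝ) - s * p := by
    linarith [Admissible.mul_lt (N := N) (s := s) (p := p)]
  have hq0 := Admissible.critExp_pos (N := N) (s := s) (p := p)
  set ω := (volume (Metric.ball (0 : RN N) 1)).toReal with hωdef
  have hω0 : 0 < ω := ENNReal.toReal_pos (Metric.measure_ball_pos _ _ one_pos).ne'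
    measure_ball_lt_top.ne
  set q := critExp N s p with hq
  set c₁ : ℝ := 2 ^ (p - 1) / ω
  set c₂ : ℝ := 2 ^ (p - 1) * ω ^ (s * p / N - 1)
  have hc₁ : 0 ≤ c₁ := by positivity
  have hc₂ : 0 ≤ c₂ := by positivity
  set K : ℝ := (2 ^ (N : ℝ) * c₁ ^ (N - s * p) * c₂ ^ (s * p)) ^ (1 / (N - s * p))
  have hK : 0 ≤ K := by positivity
  refine ⟨K ^ (1 / p), by positivity, fun u hu hfin => ?_⟩
  obtain ⟨hint, hmeas⟩ := lintegral_gagliardoFiber (s := s) hp hu.1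
  set U := (eLpNorm u (ENNReal.ofReal q) volume).toReal with hU
  have hU0 : 0 ≤ U := ENNReal.toReal_nonneg
  have hae : ∀ᵐ x, gagliardoFiber s p u x ≠ ∞ := by
    have : ∫⁻ x, gagliardoFiber s p u x ≠ ∞ := by
      rw [hint]
      exact ENNReal.rpow_ne_top_of_nonneg hp.le hfin.ne
    filter_upwards [ae_lt_top' hmeas this] with x hx using hx.ne
  -- Optimizing in `r` with exponents `sp` and `N - sp` bounds `|u x|^(pN)`; the root of order `N -
  -- sp` turns `pN` into `p^*` and leaves the fibre to the first power, ready to be integrated.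
  have hpt : ∀ᵐ x, ‖u x‖ₑ ^ q ≤ ENNReal.ofReal (K * U ^ (q - p)) * gagliardoFiber s p u x := by
    filter_upwards [hae] with x hx
    set G := (gagliardoFiber s p u x).toReal with hG
    have hG0 : 0 ≤ G := ENNReal.toReal_nonneg
    have h1 := rpow_add_le_of_forall_le (by positivity) (by positivity : 0 ≤ c₁ * G)
      (by positivity : 0 ≤ c₂ * U ^ p) hsp hd
      (fun r hr => abs_rpow_le_of_gagliardoFiber hu hx hr)
    rw [add_sub_cancel, Real.mul_rpow hc₁ hG0, Real.mul_rpow hc₂ (by positivity),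
      ← Real.rpow_mul (abs_nonneg _), ← Real.rpow_mul hU0] at h1
    have h2 := Real.rpow_le_rpow (by positivity) h1
      (by positivity : 0 ≤ 1 / ((N : ℝ) - s * p))
    rw [← Real.rpow_mul (abs_nonneg _)] at h2
    have e1 : p * N * (1 / (N - s * p)) = q := by rw [hq, critExp]; ring
    have e2 : (2 : ℝ) ^ (N : ℝ) * (c₁ ^ (N - s * p) * G ^ (N - s * p) *
        (c₂ ^ (s * p) * U ^ (p * (s * p)))) = (2 ^ (N : ℝ) * c₁ ^ (N - s * p) * c₂ ^ (s * p)) *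
        (G ^ (N - s * p) * U ^ (p * (s * p))) := by ring
    have e3 : p * (s * p) * (1 / (N - s * p)) = q - p := by
      rw [mul_one_div, hq, critExp, eq_sub_iff_add_eq, div_add' _ _ _ hd.ne']
      congr 1
      ring
    rw [e1, e2, Real.mul_rpow (by positivity) (by positivity),
      Real.mul_rpow (x := G ^ ((N : ℝ) - s * p)) (by positivity) (by positivity),
      ← Real.rpow_mul hG0, ← Real.rpow_mul hU0, e3,
      mul_one_div_cancel hd.ne', Real.rpow_one] at h2
    rw [← ENNReal.ofReal_toReal hx, ← ENNReal.ofReal_mul (by positivity),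
      Real.enorm_eq_ofReal_abs, ENNReal.ofReal_rpow_of_nonneg (abs_nonneg _) hq0.le]
    refine ENNReal.ofReal_le_ofReal (h2.trans (le_of_eq ?_))
    rw [← hG]
    ring
  have hI := lintegral_mono_ae hpt
  rw [lintegral_const_mul' _ _ ENNReal.ofReal_ne_top, hint] at hI
  have hUq : ∫⁻ x, ‖u x‖ₑ ^ q = eLpNorm u (ENNReal.ofReal q) volume ^ q := by
    rw [eLpNorm_eq_lintegral_rpow_enorm_toReal (by simpa using hq0) ENNReal.ofReal_ne_top,
      ENNReal.toReal_ofReal hq0.le, ← ENNReal.rpow_mul, one_div_mul_cancel hq0.ne',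
      ENNReal.rpow_one]
  rw [hUq] at hI
  have hR := ENNReal.toReal_mono (ENNReal.mul_ne_top ENNReal.ofReal_ne_top
    (ENNReal.rpow_ne_top_of_nonneg hp.le hfin.ne)) hI
  rw [ENNReal.toReal_mul, ← ENNReal.toReal_rpow, ← ENNReal.toReal_rpow,
    ENNReal.toReal_ofReal (by positivity), ← hU] at hR
  set g := (gagliardo s p u).toReal
  have hg : 0 ≤ g := ENNReal.toReal_nonneg
  rcases hU0.eq_or_lt with hz | hpos
  · rw [← hz]; positivity
  -- The integrated bound reads `U^q ≤ K U^(q-p) g^p`. As `u ∈ L^q` is assumed beforehand, `U` is a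
  -- genuine finite positive number and `U^(q-p)` cancels.
  · have h1 : U ^ p ≤ K * g ^ p := by
      have h2 : U ^ q = U ^ p * U ^ (q - p) := by rw [← Real.rpow_add hpos]; congr 1; ring
      rw [h2] at hR
      refine le_of_mul_le_mul_right (hR.trans (le_of_eq ?_)) (Real.rpow_pos_of_pos hpos (q - p))
      ring
    have h3 := Real.rpow_le_rpow (by positivity) h1 (by positivity : 0 ≤ 1 / p)
    rwa [Real.mul_rpow hK (by positivity), ← Real.rpow_mul hU0, ← Real.rpow_mul hg,
      mul_one_div_cancel hp.ne', Real.rpow_one, Real.rpow_one] at h3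

end Sobolev

/-! ### Completeness of `D^{s,p}(ℝ^N)` and the modulus -/

theorem tendsto_diffQuot {N : ℕ} {s p : ℝ} {u : ℕ → RN N → ℝ} {v : RN N → ℝ}
    (h : ∀ᵐ x, Tendsto (fun k => u k x) atTop (𝓝 (v x))) :
    ∀ᵐ z : RN N × RN N, Tendsto (fun k => diffQuot s p (u k) z) atTop (𝓝 (diffQuot s p v z)) := by
  rw [Measure.volume_eq_prod]
  have h1 := (Measure.quasiMeasurePreserving_fst
    (μ := (volume : Measure (RN N))) (ν := (volume : Measure (RN N)))).ae h
  have h2 := (Measure.quasiMeasurePreserving_snd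
    (μ := (volume : Measure (RN N))) (ν := (volume : Measure (RN N)))).ae h
  filter_upwards [h1, h2] with z hz1 hz2
  exact (hz1.sub hz2).div_const _

theorem gagliardo_abs_le {N : ℕ} {s p : ℝ} (hp : 0 < p) (u : RN N → ℝ) :
    gagliardo s p (fun x => |u x|) ≤ gagliardo s p u := by
  refine ENNReal.rpow_le_rpow (lintegral_mono fun z => ENNReal.ofReal_le_ofReal ?_) (by positivity)
  exact div_le_div_of_nonneg_right
    (Real.rpow_le_rpow (abs_nonneg _) (abs_abs_sub_abs_le _ _) hp.le) (by positivity)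

namespace HomSobolev

variable {N : ℕ} {s p : ℝ} [Admissible N s p]

theorem memLp_diffQuot (u : HomSobolev N s p) :
    MemLp (diffQuot s p u) (ENNReal.ofReal p) volume :=
  ⟨aestronglyMeasurable_diffQuot u.memLp.1, by
    rw [← gagliardo_eq_eLpNorm (Admissible.p_pos (N := N) (s := s))]
    exact u.gagliardo_lt_top⟩

/-- The difference quotient as a linear isometry of `D^{s,p}(ℝ^N)` into `L^p(ℝ^{2N})`. -/
def diffQuotLI [Fact (1 ≤ ENNReal.ofReal p)] :
    HomSobolev N s p →ₗᵢ[ℝ] Lp ℝ (ENNReal.ofReal p) (volume : Measure (RN N × RN N)) where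
  toFun u := u.memLp_diffQuot.toLp _
  map_add' u v := by
    rw [← MemLp.toLp_add, MemLp.toLp_eq_toLp_iff, ← diffQuot_add]
    exact diffQuot_congr (coe_add u v)
  map_smul' c u := by
    rw [RingHom.id_apply, ← MemLp.toLp_const_smul, MemLp.toLp_eq_toLp_iff, ← diffQuot_smul]
    exact diffQuot_congr (coe_smul c u)
  norm_map' u := by
    change ‖u.memLp_diffQuot.toLp _‖ = _
    rw [Lp.norm_toLp, norm_def, gagliardo_eq_eLpNorm (Admissible.p_pos (N := N) (s := s))]

theorem coe_diffQuotLI [Fact (1 ≤ ENNReal.ofReal p)] (u : HomSobolev N s p) :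
    ⇑(diffQuotLI u) =ᵐ[volume] diffQuot s p u :=
  u.memLp_diffQuot.coeFn_toLp

/-- The element of `D^{s,p}(ℝ^N)` given by a function in `L^{p^*}` of finite seminorm. -/
def ofMemLp (u : RN N → ℝ) (hu : MemLp u (ENNReal.ofReal (critExp N s p)) volume)
    (hg : gagliardo s p u < ∞) : HomSobolev N s p :=
  ⟨hu.toLp u, by
    change gagliardo s p (hu.toLp u : RN N → ℝ) < ∞
    rwa [gagliardo_congr (Admissible.p_pos (N := N) (s := s)) hu.coeFn_toLp]⟩

theorem coe_ofMemLp (u : RN N → ℝ) (hu : MemLp u (ENNReal.ofReal (critExp N s p)) volume)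
    (hg : gagliardo s p u < ∞) : ⇑(ofMemLp u hu hg) =ᵐ[volume] u :=
  hu.coeFn_toLp

/-- An element of `D^{s,p}(ℝ^N)` as an element of `L^{p^*}(ℝ^N)`. -/
def toLp (u : HomSobolev N s p) : Lp ℝ (ENNReal.ofReal (critExp N s p)) (volume : Measure (RN N)) :=
  u.1

theorem exists_norm_le (N : ℕ) (s p : ℝ) [Admissible N s p] : ∃ C : ℝ, 0 ≤ C ∧
    ∀ u : HomSobolev N s p,
      (eLpNorm u (ENNReal.ofReal (critExp N s p)) volume).toReal ≤ C * ‖u‖ := by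
  obtain ⟨C, hC, h⟩ := exists_eLpNorm_critExp_le_gagliardo N s p
  exact ⟨C, hC, fun u => h u u.memLp u.gagliardo_lt_top⟩

/-- By the Sobolev inequality a Cauchy sequence converges in `L^{p^*}`, and its difference quotients
converge in `L^p(ℝ^{2N})`. Almost everywhere convergence along a common subsequence shows that the
second limit is the difference quotient of the first. -/
instance : CompleteSpace (HomSobolev N s p) := by
  have hp2 : 2 ≤ p := Admissible.two_le N s
  have hpq := Admissible.lt_critExp (N := N) (s := s) (p := p)
  have : Fact (1 ≤ ENNReal.ofReal p) := ⟨by simp; linarith⟩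
  have : Fact (1 ≤ ENNReal.ofReal (critExp N s p)) := ⟨by simp; linarith⟩
  refine Metric.complete_of_cauchySeq_tendsto fun u hu => ?_
  obtain ⟨C, hC, hCu⟩ := exists_norm_le N s p
  have hcau : CauchySeq fun n => (u n).toLp := by
    have hdist : ∀ m n, dist (u m).toLp (u n).toLp ≤ C * dist (u m) (u n) := fun m n => by
      rw [dist_eq_norm, dist_eq_norm]
      exact hCu (u m - u n)
    rw [Metric.cauchySeq_iff'] at hu ⊢
    intro ε hε
    -- `C + 1` in place of `C`, which may be `0`.
    obtain ⟨n₀, hn₀⟩ := hu (ε / (C + 1)) (by positivity)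
    refine ⟨n₀, fun n hn => (hdist n n₀).trans_lt ?_⟩
    have h1 := hn₀ n hn
    rw [lt_div_iff₀ (by positivity)] at h1
    nlinarith [dist_nonneg (x := u n) (y := u n₀)]
  obtain ⟨v, hv⟩ := cauchySeq_tendsto_of_complete hcau
  obtain ⟨w, hw⟩ := cauchySeq_tendsto_of_complete
    ((diffQuotLI (N := N) (s := s) (p := p)).isometry.uniformContinuous.comp_cauchySeq hu)
  obtain ⟨k, hk, hkv⟩ := (tendstoInMeasure_of_tendsto_Lp hv).exists_seq_tendsto_ae
  obtain ⟨l, hl, hlw⟩ := (tendstoInMeasure_of_tendsto_Lp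
    (hw.comp hk.tendsto_atTop)).exists_seq_tendsto_ae
  have hwv : w =ᵐ[volume] diffQuot s p v := by
    have h3 : ∀ᵐ z, ∀ n, diffQuotLI (u n) z = diffQuot s p (u n) z :=
      ae_all_iff.2 fun n => coe_diffQuotLI (u n)
    filter_upwards [hlw, tendsto_diffQuot (s := s) (p := p) hkv, h3] with z hz1 hz2 hz3
    refine tendsto_nhds_unique hz1 ?_
    simp only [Function.comp, hz3]
    exact hz2.comp hl.tendsto_atTop
  have hg : gagliardo s p v < ∞ := by
    rw [gagliardo_eq_eLpNorm (by linarith), ← eLpNorm_congr_ae hwv]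
    exact Lp.eLpNorm_lt_top w
  refine ⟨ofMemLp v (Lp.memLp v) hg, ?_⟩
  have hD : diffQuotLI (ofMemLp (s := s) (p := p) v (Lp.memLp v) hg) = w := by
    refine Lp.ext ((coe_diffQuotLI _).trans ?_)
    exact (diffQuot_congr (coe_ofMemLp _ _ _)).trans hwv.symm
  rw [tendsto_iff_norm_sub_tendsto_zero] at hw ⊢
  refine hw.congr fun n => ?_
  rw [← hD, Function.comp_apply, ← map_sub, LinearIsometry.norm_map]

/-- The modulus of an element of `D^{s,p}(ℝ^N)`. -/
def modulus (u : HomSobolev N s p) : HomSobolev N s p :=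
  ofMemLp (fun x => |u x|) u.memLp.abs
    ((gagliardo_abs_le (Admissible.p_pos (N := N) (s := s)) u).trans_lt u.gagliardo_lt_top)

theorem coe_modulus (u : HomSobolev N s p) : ⇑(modulus u) =ᵐ[volume] fun x => |u x| :=
  coe_ofMemLp _ _ _

theorem norm_modulus_le (u : HomSobolev N s p) : ‖modulus u‖ ≤ ‖u‖ := by
  have hp : 0 < p := Admissible.p_pos (N := N) (s := s)
  rw [norm_def, norm_def, gagliardo_congr hp (coe_modulus u)]
  exact ENNReal.toReal_mono u.gagliardo_lt_top.ne (gagliardo_abs_le hp u)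

end HomSobolev

/-! ### Uniform convexity and existence of minimizers -/

/-- With `|t|^q = (t²)^(q/2)` and `q/2 ≥ 1`: superadditivity of the power `q/2`, then the
parallelogram identity, then convexity of the same power. -/
theorem abs_half_add_rpow_add_abs_half_sub_rpow_le {q : ℝ} (hq : 2 ≤ q) (a b : ℝ) :
    |(1 / 2) * (a + b)| ^ q + |(1 / 2) * (a - b)| ^ q ≤ (1 / 2) * (|a| ^ q + |b| ^ q) := by
  have e : ∀ t : ℝ, |t| ^ q = (t ^ 2) ^ (q / 2) := fun t => by
    rw [← sq_abs, ← Real.rpow_natCast, ← Real.rpow_mul (abs_nonneg t)]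
    congr 1
    push_cast
    ring
  simp only [e]
  have h1 := NNReal.add_rpow_le_rpow_add (p := q / 2) ⟨((1 / 2) * (a + b)) ^ 2, sq_nonneg _⟩
    ⟨((1 / 2) * (a - b)) ^ 2, sq_nonneg _⟩ (by linarith)
  have h2 : (((1 / 2) * (a + b)) ^ 2) ^ (q / 2) + (((1 / 2) * (a - b)) ^ 2) ^ (q / 2) ≤
      (((1 / 2) * (a + b)) ^ 2 + ((1 / 2) * (a - b)) ^ 2) ^ (q / 2) := by exact_mod_cast h1
  refine h2.trans ?_
  have h3 := (convexOn_rpow (p := q / 2) (by linarith)).2 (Set.mem_Ici.2 (sq_nonneg a))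
    (Set.mem_Ici.2 (sq_nonneg b)) (by norm_num : (0 : ℝ) ≤ 1 / 2) (by norm_num : (0 : ℝ) ≤ 1 / 2)
    (by norm_num)
  simp only [smul_eq_mul] at h3
  have e2 : ((1 / 2) * (a + b)) ^ 2 + ((1 / 2) * (a - b)) ^ 2 =
      1 / 2 * a ^ 2 + 1 / 2 * b ^ 2 := by ring
  rw [e2]
  linarith

/-- Clarkson's first inequality. -/
theorem MeasureTheory.Lp.norm_half_add_rpow_add_norm_half_sub_rpow_le {X : Type*} [MeasurableSpace X]
    {μ : Measure X} {q : ℝ} (hq : 2 ≤ q) [Fact (1 ≤ ENNReal.ofReal q)]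
    (f g : Lp ℝ (ENNReal.ofReal q) μ) :
    ‖(1 / 2 : ℝ) • (f + g)‖ ^ q + ‖(1 / 2 : ℝ) • (f - g)‖ ^ q ≤
      (1 / 2) * (‖f‖ ^ q + ‖g‖ ^ q) := by
  have hq0 : 0 < q := by linarith
  have hint : ∀ h : Lp ℝ (ENNReal.ofReal q) μ, Integrable (fun x => |h x| ^ q) μ := fun h => by
    have := (Lp.memLp h).integrable_norm_rpow (by simpa using hq0) ENNReal.ofReal_ne_top
    rwa [ENNReal.toReal_ofReal hq0.le] at this
  simp only [← integral_abs_rpow_eq_norm_rpow hq0]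
  rw [← integral_add (hint _) (hint _), ← integral_add (hint _) (hint _), ← integral_const_mul]
  refine integral_mono_ae ((hint _).add (hint _)) (((hint _).add (hint _)).const_mul _) ?_
  filter_upwards [Lp.coeFn_smul (1 / 2 : ℝ) (f + g), Lp.coeFn_smul (1 / 2 : ℝ) (f - g),
    Lp.coeFn_add f g, Lp.coeFn_sub f g] with x h1 h2 h3 h4
  simp only [h1, h2, Pi.smul_apply, h3, h4, Pi.add_apply, Pi.sub_apply, smul_eq_mul]
  exact abs_half_add_rpow_add_abs_half_sub_rpow_le hq _ _

theorem HomSobolev.norm_half_add_rpow_add_norm_half_sub_rpow_le {N : ℕ} {s p : ℝ}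
    [Admissible N s p] (u v : HomSobolev N s p) :
    ‖(1 / 2 : ℝ) • (u + v)‖ ^ p + ‖(1 / 2 : ℝ) • (u - v)‖ ^ p ≤
      (1 / 2) * (‖u‖ ^ p + ‖v‖ ^ p) := by
  have hp2 : 2 ≤ p := Admissible.two_le N s
  have : Fact (1 ≤ ENNReal.ofReal p) := ⟨by simp; linarith⟩
  simpa only [← map_add, ← map_sub, ← map_smul, LinearIsometry.norm_map] using
    Lp.norm_half_add_rpow_add_norm_half_sub_rpow_le hp2 (HomSobolev.diffQuotLI u)
      (HomSobolev.diffQuotLI v)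

/-- A continuous, uniformly convex functional that is bounded below attains its minimum. -/
theorem exists_forall_le_of_uniformly_convex {E : Type*} [NormedAddCommGroup E]
    [NormedSpace ℝ E] [CompleteSpace E] {J : E → ℝ} (hJ : Continuous J)
    (hb : BddBelow (Set.range J)) {c q : ℝ} (hc : 0 < c) (hq : 0 < q)
    (h : ∀ u v, J ((1 / 2 : ℝ) • (u + v)) + c * ‖u - v‖ ^ q ≤ (1 / 2) * (J u + J v)) :
    ∃ u, ∀ v, J u ≤ J v := by
  set m := ⨅ u, J u
  have hm : ∀ v, m ≤ J v := fun v => ciInf_le hb v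
  have hex : ∀ n : ℕ, ∃ u, J u < m + 1 / ((n : ℝ) + 1) := fun n =>
    exists_lt_of_ciInf_lt (lt_add_of_pos_right _ Nat.one_div_pos_of_nat)
  choose u hu using hex
  have h0 : Tendsto (fun n : ℕ => (1 / ((n : ℝ) + 1) / c) ^ (1 / q)) atTop (𝓝 0) := by
    have h1 := (tendsto_one_div_add_atTop_nhds_zero_nat (𝕜 := ℝ)).div_const c
    have h2 := h1.rpow_const (p := 1 / q) (Or.inr (by positivity))
    rwa [zero_div, Real.zero_rpow (by positivity)] at h2
  have hcau : CauchySeq u := by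
    refine cauchySeq_of_le_tendsto_0 _ (fun i j k hi hj => ?_) h0
    -- The midpoint has energy at least `m` while both ends have energy at most `m + 1/(k+1)`, so
    -- the convexity gap bounds `c ‖u i - u j‖^q` by `1/(k+1)`.
    have h1 := h (u i) (u j)
    have h2 := hm ((1 / 2 : ℝ) • (u i + u j))
    have h3 : ∀ i, k ≤ i → J (u i) ≤ m + 1 / ((k : ℝ) + 1) := fun i hi =>
      (hu i).le.trans (by gcongr)
    have h4 : ‖u i - u j‖ ^ q ≤ 1 / ((k : ℝ) + 1) / c := by
      rw [le_div_iff₀ hc]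
      linarith [h3 i hi, h3 j hj]
    have h5 := Real.rpow_le_rpow (by positivity) h4 (by positivity : 0 ≤ 1 / q)
    rwa [← Real.rpow_mul (norm_nonneg _), mul_one_div_cancel hq.ne', Real.rpow_one,
      ← dist_eq_norm] at h5
  obtain ⟨w, hw⟩ := cauchySeq_tendsto_of_complete hcau
  refine ⟨w, fun v => le_trans ?_ (hm v)⟩
  have h1 : Tendsto (fun n : ℕ => m + 1 / ((n : ℝ) + 1)) atTop (𝓝 (m + 0)) :=
    tendsto_const_nhds.add tendsto_one_div_add_atTop_nhds_zero_nat
  rw [add_zero] at h1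
  exact le_of_tendsto_of_tendsto' ((hJ.tendsto w).comp hw) h1 fun n => (hu n).le

/-- A convex continuous function is lower semicontinuous for the weak topology. -/
theorem ConvexOn.lowerSemicontinuous_weakSpace {E : Type*} [NormedAddCommGroup E]
    [NormedSpace ℝ E] {J : E → ℝ} (hJ : ConvexOn ℝ Set.univ J) (hc : Continuous J) :
    LowerSemicontinuous fun u : WeakSpace ℝ E => J ((toWeakSpace ℝ E).symm u) := by
  rw [lowerSemicontinuous_iff_isClosed_preimage]
  intro c
  have hconv : Convex ℝ {u | J u ≤ c} := by simpa using hJ.convex_le c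
  have hcl : IsClosed {u | J u ≤ c} := isClosed_le hc continuous_const
  -- Mazur: the closure of a convex set is the same in the norm and weak topologies, so closed
  -- convex sublevel sets are weakly closed.
  have h1 := hconv.toWeakSpace_closure ℝ
  rw [hcl.closure_eq] at h1
  have h2 : (fun u : WeakSpace ℝ E => J ((toWeakSpace ℝ E).symm u)) ⁻¹' Set.Iic c =
      toWeakSpace ℝ E '' {u | J u ≤ c} := by
    ext u
    simp only [Set.mem_preimage, Set.mem_Iic, Set.mem_image, Set.mem_ofPred_eq]
    refine ⟨fun hu => ⟨_, hu, by simp⟩, ?_⟩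
    rintro ⟨v, hv, rfl⟩
    simpa using hv
  rw [h2, h1]
  exact isClosed_closure

/-! ### The regularized nonlinearity -/

/-- The regularized singular term `(t_+ + ε)^{-γ}`. -/
def regKernel (γ ε t : ℝ) : ℝ := (max t 0 + ε) ^ (-γ)

/-- The primitive `∫_0^t (τ_+ + ε)^{-γ} dτ`. -/
def regKernelPrimitive (γ ε t : ℝ) : ℝ := ∫ τ in (0 : ℝ)..t, regKernel γ ε τ

section Kernel

variable {γ ε : ℝ}

theorem regKernel_nonneg (hε : 0 < ε) (t : ℝ) : 0 ≤ regKernel γ ε t :=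
  Real.rpow_nonneg (by positivity) _

theorem regKernel_antitone (hγ : 0 < γ) (hε : 0 < ε) : Antitone (regKernel γ ε) := by
  intro a b hab
  exact Real.rpow_le_rpow_of_nonpos (by positivity)
    (add_le_add_left (max_le_max_right 0 hab) ε) (by linarith)

theorem regKernel_le (hγ : 0 < γ) (hε : 0 < ε) (t : ℝ) : regKernel γ ε t ≤ ε ^ (-γ) :=
  Real.rpow_le_rpow_of_nonpos hε (le_add_of_nonneg_left (le_max_right _ _)) (by linarith)

/-- The derivative of `x^(-γ)` on `[ε, ∞)` is at most `γ ε^(-γ-1)` in modulus, and `t ↦ t_+` is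
1-Lipschitz. -/
theorem abs_regKernel_sub_le (hγ : 0 < γ) (hε : 0 < ε) (a b : ℝ) :
    |regKernel γ ε a - regKernel γ ε b| ≤ γ * ε ^ (-γ - 1) * |a - b| := by
  have h1 := Convex.norm_image_sub_le_of_norm_hasDerivWithin_le (𝕜 := ℝ)
    (f := fun x : ℝ => x ^ (-γ)) (f' := fun x => -γ * x ^ (-γ - 1)) (s := Set.Ici ε)
    (x := max b 0 + ε) (y := max a 0 + ε) (C := γ * ε ^ (-γ - 1))
    (fun x hx => (Real.hasDerivAt_rpow_const
      (Or.inl (hε.trans_le hx).ne')).hasDerivWithinAt)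
    (fun x hx => by
      have hx0 : 0 < x := hε.trans_le hx
      rw [norm_mul, norm_neg, Real.norm_of_nonneg hγ.le, Real.norm_of_nonneg (by positivity)]
      exact mul_le_mul_of_nonneg_left (Real.rpow_le_rpow_of_nonpos hε hx (by linarith)) hγ.le)
    (convex_Ici ε) (Set.mem_Ici.2 (le_add_of_nonneg_left (le_max_right _ _)))
    (Set.mem_Ici.2 (le_add_of_nonneg_left (le_max_right _ _)))
  simp only [Real.norm_eq_abs, add_sub_add_right_eq_sub] at h1
  exact h1.trans (mul_le_mul_of_nonneg_left (abs_max_sub_max_le_abs _ _ _) (by positivity))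

theorem continuous_regKernel (hε : 0 < ε) : Continuous (regKernel γ ε) :=
  ((continuous_id.max continuous_const).add continuous_const).rpow_const fun t =>
    Or.inl (by positivity : 0 < max t 0 + ε).ne'

theorem hasDerivAt_regKernelPrimitive (hε : 0 < ε) (t : ℝ) :
    HasDerivAt (regKernelPrimitive γ ε) (regKernel γ ε t) t :=
  ((continuous_regKernel hε).integral_hasStrictDerivAt 0 t).hasDerivAt

theorem deriv_regKernelPrimitive (hε : 0 < ε) :
    deriv (regKernelPrimitive γ ε) = regKernel γ ε :=
  funext fun t => (hasDerivAt_regKernelPrimitive hε t).deriv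

theorem regKernelPrimitive_zero : regKernelPrimitive γ ε 0 = 0 :=
  intervalIntegral.integral_same

theorem hasPowerLipschitzDeriv_regKernelPrimitive (hγ : 0 < γ) (hε : 0 < ε) :
    HasPowerLipschitzDeriv 2 (γ * ε ^ (-γ - 1)) (regKernelPrimitive γ ε) (regKernel γ ε) where
  two_le := le_rfl
  nonneg := by positivity
  map_zero := regKernelPrimitive_zero
  hasDerivAt := hasDerivAt_regKernelPrimitive hε
  abs_sub_le a b := by simpa using abs_regKernel_sub_le hγ hε a b

theorem concaveOn_regKernelPrimitive (hγ : 0 < γ) (hε : 0 < ε) :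
    ConcaveOn ℝ Set.univ (regKernelPrimitive γ ε) := by
  refine Antitone.concaveOn_univ_of_deriv
    (fun t => (hasDerivAt_regKernelPrimitive hε t).differentiableAt) ?_
  rw [deriv_regKernelPrimitive hε]
  exact regKernel_antitone hγ hε

theorem monotone_regKernelPrimitive (hε : 0 < ε) : Monotone (regKernelPrimitive γ ε) := by
  refine monotone_of_deriv_nonneg
    (fun t => (hasDerivAt_regKernelPrimitive hε t).differentiableAt) fun t => ?_
  rw [deriv_regKernelPrimitive hε]
  exact regKernel_nonneg hε t

theorem abs_regKernelPrimitive_le (hγ : 0 < γ) (hε : 0 < ε) (t : ℝ) :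
    |regKernelPrimitive γ ε t| ≤ ε ^ (-γ) * |t| := by
  have := intervalIntegral.norm_integral_le_of_norm_le_const (a := 0) (b := t)
    (f := regKernel γ ε) (C := ε ^ (-γ)) fun x _ => by
      rw [Real.norm_of_nonneg (regKernel_nonneg hε x)]
      exact regKernel_le hγ hε x
  rwa [sub_zero] at this

/-- A bound on the primitive that does not depend on the regularization parameter. -/
theorem regKernelPrimitive_le (hγ : 0 < γ) (hγ1 : γ < 1) (hε : 0 < ε) (t : ℝ) :
    regKernelPrimitive γ ε t ≤ (1 - γ)⁻¹ * (1 + |t|) := by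
  have h1γ : 0 < 1 - γ := by linarith
  rcases le_total t 0 with ht | ht
  · refine (monotone_regKernelPrimitive hε ht).trans ?_
    rw [regKernelPrimitive_zero]
    positivity
  -- Dropping `ε` removes the dependence on it; the singularity at `0` stays integrable because `γ <
  -- 1`.
  · have h1 : regKernelPrimitive γ ε t ≤ ∫ τ in (0 : ℝ)..t, τ ^ (-γ) := by
      refine intervalIntegral.integral_mono_on_of_le_Ioo ht
        ((continuous_regKernel hε).intervalIntegrable _ _)
        (intervalIntegral.intervalIntegrable_rpow' (by linarith)) fun x hx => ?_
      exact Real.rpow_le_rpow_of_nonpos hx.1 (by linarith [le_max_left x 0]) (by linarith)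
    rw [integral_rpow (Or.inl (by linarith)), neg_add_eq_sub, Real.zero_rpow h1γ.ne', sub_zero,
      div_eq_inv_mul] at h1
    refine h1.trans (mul_le_mul_of_nonneg_left ?_ (by positivity))
    have h2 : t ^ (1 - γ) ≤ (1 + t) ^ (1 - γ) := Real.rpow_le_rpow ht (by linarith) h1γ.le
    have h3 : (1 + t) ^ (1 - γ) ≤ (1 + t) ^ (1 : ℝ) :=
      Real.rpow_le_rpow_of_exponent_le (by linarith) (by linarith)
    rw [Real.rpow_one] at h3
    rw [abs_of_nonneg ht]
    linarith

end Kernel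

/-! ### Lebesgue spaces of a finite measure -/

section FiniteMeasure

variable {X : Type*} [MeasurableSpace X] {μ : Measure X} [IsFiniteMeasure μ] {q : ℝ}

theorem integrable_of_Lp (hq : 1 ≤ q) (h : Lp ℝ (ENNReal.ofReal q) μ) : Integrable h μ :=
  (Lp.memLp h).integrable (by simpa using hq)

theorem integral_abs_le_of_Lp (hq : 1 ≤ q) (h : Lp ℝ (ENNReal.ofReal q) μ) :
    ∫ x, |h x| ∂μ ≤ (μ Set.univ ^ (1 - 1 / q)).toReal * ‖h‖ := by
  have h1 := eLpNorm_le_eLpNorm_mul_rpow_measure_univ (p := 1) (q := ENNReal.ofReal q)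
    (by simpa using hq) (Lp.aestronglyMeasurable h)
  rw [ENNReal.toReal_one, ENNReal.toReal_ofReal (by linarith), div_one] at h1
  have h2 : 0 ≤ 1 - 1 / q := by
    rw [sub_nonneg, div_le_one (by linarith)]
    exact hq
  have h3 := ENNReal.toReal_mono (ENNReal.mul_ne_top (Lp.eLpNorm_ne_top h)
    (ENNReal.rpow_ne_top_of_nonneg h2 (measure_ne_top μ _))) h1
  rw [ENNReal.toReal_mul, ← Lp.norm_def, mul_comm] at h3
  refine le_trans (le_of_eq ?_) h3
  rw [eLpNorm_one_eq_lintegral_enorm, ← integral_norm_eq_lintegral_enorm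
    (Lp.aestronglyMeasurable h)]
  rfl

theorem constBounded_of_isFiniteMeasure (hq : 1 ≤ q) (c : ℝ) :
    HasPowerLipschitzDeriv.ConstBounded μ q c (|c| * (μ Set.univ ^ (1 - 1 / q)).toReal) := by
  refine fun h => ⟨(integrable_of_Lp hq h).const_mul c, ?_⟩
  rw [integral_const_mul, abs_mul, mul_assoc]
  exact mul_le_mul_of_nonneg_left
    ((abs_integral_le_integral_abs).trans (integral_abs_le_of_Lp hq h)) (abs_nonneg c)

end FiniteMeasure

theorem constBounded_zero {X : Type*} [MeasurableSpace X] (μ : Measure X) (q : ℝ) :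
    HasPowerLipschitzDeriv.ConstBounded μ q 0 0 := fun h => by simp

/-! ### The weighted measure -/

/-- The measure `a(x) dx`. -/
def weightedVolume {N : ℕ} (a : RN N → ℝ) : Measure (RN N) :=
  volume.withDensity fun x => ENNReal.ofReal (a x)

section Weighted

variable {N : ℕ} {a : RN N → ℝ}

theorem weightedVolume_absolutelyContinuous : weightedVolume a ≪ volume :=
  withDensity_absolutelyContinuous _ _

theorem isFiniteMeasure_weightedVolume (hint : Integrable a) :
    IsFiniteMeasure (weightedVolume a) :=
  isFiniteMeasure_withDensity_ofReal hint.2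

theorem integral_weightedVolume (ha : Measurable a) (h0 : ∀ x, 0 ≤ a x) (f : RN N → ℝ) :
    ∫ x, f x ∂(weightedVolume a) = ∫ x, a x * f x := by
  rw [weightedVolume, integral_withDensity_eq_integral_toReal_smul ha.ennreal_ofReal
    (Eventually.of_forall fun _ => ENNReal.ofReal_lt_top)]
  simp only [ENNReal.toReal_ofReal (h0 _), smul_eq_mul]

theorem integrable_weightedVolume_iff (ha : Measurable a) (h0 : ∀ x, 0 ≤ a x) {f : RN N → ℝ} :
    Integrable f (weightedVolume a) ↔ Integrable fun x => a x * f x := by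
  rw [weightedVolume, integrable_withDensity_iff_integrable_smul' ha.ennreal_ofReal
    (Eventually.of_forall fun _ => ENNReal.ofReal_lt_top)]
  simp only [ENNReal.toReal_ofReal (h0 _), smul_eq_mul]

theorem weightedVolume_le {c : ℝ} (hle : ∀ x, a x ≤ c) :
    weightedVolume a ≤ ENNReal.ofReal c • volume := by
  rw [← withDensity_const]
  exact withDensity_mono (Eventually.of_forall fun x => ENNReal.ofReal_le_ofReal (hle x))

/-- Integrability of `a` makes `a dx` finite, so Hölder lowers the exponent from `q` to `r`;
boundedness of `a` then compares `a dx` with Lebesgue measure. -/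
theorem exists_eLpNorm_weightedVolume_le {c r q : ℝ} (hle : ∀ x, a x ≤ c) (hint : Integrable a)
    (hr : 0 < r) (hrq : r ≤ q) : ∃ C : ℝ≥0∞, C ≠ ∞ ∧ ∀ u : RN N → ℝ,
      AEStronglyMeasurable u volume →
      eLpNorm u (ENNReal.ofReal r) (weightedVolume a) ≤
        C * eLpNorm u (ENNReal.ofReal q) volume := by
  have := isFiniteMeasure_weightedVolume hint
  have hq : 0 < q := hr.trans_le hrq
  have hexp : 0 ≤ 1 / r - 1 / q := by
    rw [sub_nonneg]
    exact one_div_le_one_div_of_le hr hrq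
  refine ⟨ENNReal.ofReal c ^ (1 / ENNReal.ofReal q).toReal *
    weightedVolume a Set.univ ^ (1 / r - 1 / q), ENNReal.mul_ne_top
      (ENNReal.rpow_ne_top_of_nonneg ENNReal.toReal_nonneg ENNReal.ofReal_ne_top)
      (ENNReal.rpow_ne_top_of_nonneg hexp (measure_ne_top _ _)), fun u hu => ?_⟩
  have h1 := eLpNorm_le_eLpNorm_mul_rpow_measure_univ (ENNReal.ofReal_le_ofReal hrq)
    (hu.mono_ac (weightedVolume_absolutelyContinuous (a := a)))
  rw [ENNReal.toReal_ofReal hr.le, ENNReal.toReal_ofReal hq.le] at h1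
  have h2 := eLpNorm_mono_measure (p := ENNReal.ofReal q) u (weightedVolume_le hle)
  rw [eLpNorm_smul_measure_of_ne_top ENNReal.ofReal_ne_top, smul_eq_mul] at h2
  calc _ ≤ _ := h1
    _ ≤ _ := mul_le_mul_left h2 _
    _ = _ := by ring

variable {s p : ℝ} [Admissible N s p]

theorem exists_embedding_weightedVolume [Fact (1 ≤ ENNReal.ofReal 2)] {c : ℝ}
    (hle : ∀ x, a x ≤ c) (hint : Integrable a) :
    ∃ ι : HomSobolev N s p →L[ℝ] Lp ℝ (ENNReal.ofReal 2) (weightedVolume a),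
      ∀ u, ⇑(ι u) =ᵐ[weightedVolume a] ⇑u := by
  have hp2 : 2 ≤ p := Admissible.two_le N s
  have hpq := Admissible.lt_critExp (N := N) (s := s) (p := p)
  obtain ⟨C, hC, hCu⟩ := exists_eLpNorm_weightedVolume_le hle hint (two_pos (α := ℝ))
    (hp2.trans hpq.le)
  obtain ⟨S, hS, hSu⟩ := HomSobolev.exists_norm_le N s p
  have hmem : ∀ u : HomSobolev N s p, MemLp u (ENNReal.ofReal 2) (weightedVolume a) := fun u =>
    ⟨u.memLp.1.mono_ac weightedVolume_absolutelyContinuous,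
      (hCu u u.memLp.1).trans_lt (ENNReal.mul_lt_top hC.lt_top u.memLp.2)⟩
  refine ⟨LinearMap.mkContinuous
    { toFun := fun u => (hmem u).toLp u
      map_add' := fun u v => by
        rw [← MemLp.toLp_add, MemLp.toLp_eq_toLp_iff]
        exact weightedVolume_absolutelyContinuous.ae_eq (HomSobolev.coe_add u v)
      map_smul' := fun c u => by
        rw [RingHom.id_apply, ← MemLp.toLp_const_smul, MemLp.toLp_eq_toLp_iff]
        exact weightedVolume_absolutelyContinuous.ae_eq (HomSobolev.coe_smul c u) }
    (C.toReal * S) (fun u => ?_), fun u => (hmem u).coeFn_toLp⟩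
  simp only [LinearMap.coe_mk, AddHom.coe_mk]
  rw [Lp.norm_toLp, mul_assoc]
  refine le_trans ?_ (mul_le_mul_of_nonneg_left (hSu u) ENNReal.toReal_nonneg)
  rw [← ENNReal.toReal_mul]
  exact ENNReal.toReal_mono (ENNReal.mul_ne_top hC u.memLp.2.ne) (hCu u u.memLp.1)

end Weighted

theorem weight_le_one {N : ℕ} (α : ℝ) (x : RN N) : weight α x ≤ 1 := by
  have h : 0 ≤ ‖x‖ ^ ((N : ℝ) + α) := by positivity
  rw [weight, div_le_one (by positivity)]
  linarith

/-- Comparison with `(1 + |x|)^(-(N+α))`, through `(1 + t)^m ≤ 2^m max(1, t)^m ≤ 2^m (1 + t^m)`. -/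
theorem integrable_weight {N : ℕ} {α : ℝ} (hα : 0 < α) :
    Integrable (weight α : RN N → ℝ) := by
  have hr : 0 ≤ (N : ℝ) + α := by positivity
  have h1 := (integrable_one_add_norm (E := RN N) (μ := volume) (r := (N : ℝ) + α)
    (by rw [finrank_euclideanSpace_fin]; linarith)).const_mul (2 ^ ((N : ℝ) + α))
  have hm : Measurable (weight α : RN N → ℝ) := by
    unfold weight
    fun_prop
  refine h1.mono' hm.aestronglyMeasurable (Eventually.of_forall fun x => ?_)
  have h0 : 0 ≤ ‖x‖ ^ ((N : ℝ) + α) := by positivity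
  have hx := norm_nonneg x
  rw [weight, Real.norm_of_nonneg (by positivity), Real.rpow_neg (by positivity),
    ← div_eq_mul_inv, div_le_div_iff₀ (by positivity) (by positivity), one_mul]
  have h2 : (1 + ‖x‖) ^ ((N : ℝ) + α) ≤ (2 * max 1 ‖x‖) ^ ((N : ℝ) + α) := by
    refine Real.rpow_le_rpow (by positivity) ?_ hr
    linarith [le_max_left 1 ‖x‖, le_max_right 1 ‖x‖]
  rw [Real.mul_rpow zero_le_two (by positivity)] at h2
  refine h2.trans (mul_le_mul_of_nonneg_left ?_ (by positivity))
  rcases le_total 1 ‖x‖ with h | h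
  · rw [max_eq_right h]; linarith
  · rw [max_eq_left h, Real.one_rpow]; linarith

/-! ### The energy functional -/

theorem regPrimitive_eq {N : ℕ} (a : RN N → ℝ) (γ : ℝ) (n : ℕ) (x : RN N) (t : ℝ) :
    regPrimitive a γ n x t = a x * regKernelPrimitive γ (1 / (n : ℝ)) t :=
  intervalIntegral.integral_const_mul _ _

/-- Replaces `p`-growth by quadratic growth, so that the coercivity and boundedness estimates reduce
to quadratic inequalities. -/
theorem sq_sub_one_le_rpow {p t : ℝ} (hp : 2 ≤ p) (ht : 0 ≤ t) : t ^ 2 - 1 ≤ t ^ p := by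
  rcases le_total 1 t with h | h
  · have := Real.rpow_le_rpow_of_exponent_le h hp
    rw [Real.rpow_two] at this
    linarith
  · have : 0 ≤ t ^ p := Real.rpow_nonneg ht p
    nlinarith

/-- The integrand of the fractional `p`-Laplacian in terms of difference quotients. -/
theorem fracPLaplacianIntegrand_eq {N : ℕ} {s p : ℝ} (hp : 0 < p) (u v : RN N → ℝ)
    (z : RN N × RN N) :
    fracPLaplacianIntegrand s p u v z =
      |diffQuot s p u z| ^ (p - 2) * diffQuot s p u z * diffQuot s p v z := by
  by_cases hz : z.1 = z.2
  · simp [fracPLaplacianIntegrand, diffQuot, hz]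
  · have hr : 0 < ‖z.1 - z.2‖ := norm_pos_iff.2 (sub_ne_zero.2 hz)
    rw [fracPLaplacianIntegrand]
    simp only [diffQuot]
    set m := ((N : ℝ) + s * p) / p
    -- The kernel exponent is shared among the three factors, `m` for each power of a difference
    -- quotient.
    have hm : (N : ℝ) + s * p = m * (p - 2) + m + m := by
      simp only [m]
      field_simp
      ring
    rw [hm, Real.rpow_add hr, Real.rpow_add hr, abs_div,
      abs_of_pos (Real.rpow_pos_of_pos hr m), Real.div_rpow (abs_nonneg _) (by positivity),
      ← Real.rpow_mul hr.le]
    field_simp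

namespace HomSobolev

variable {N : ℕ} {s p : ℝ} [Admissible N s p]

theorem convexOn_norm_rpow : ConvexOn ℝ Set.univ fun u : HomSobolev N s p => 1 / p * ‖u‖ ^ p := by
  have hp2 : 2 ≤ p := Admissible.two_le N s
  refine ⟨convex_univ, fun u _ v _ b c hb hc hbc => ?_⟩
  have h1 : ‖b • u + c • v‖ ≤ b * ‖u‖ + c * ‖v‖ := by
    refine (norm_add_le _ _).trans (le_of_eq ?_)
    rw [norm_smul, norm_smul, Real.norm_of_nonneg hb, Real.norm_of_nonneg hc]
  have h2 := Real.rpow_le_rpow (norm_nonneg _) h1 (by linarith : 0 ≤ p)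
  have h3 := (convexOn_rpow (p := p) (by linarith)).2 (Set.mem_Ici.2 (norm_nonneg u))
    (Set.mem_Ici.2 (norm_nonneg v)) hb hc hbc
  simp only [smul_eq_mul] at h3 ⊢
  have h4 := mul_le_mul_of_nonneg_left (h2.trans h3) (by positivity : 0 ≤ 1 / p)
  linarith

end HomSobolev

theorem constBounded_abs_rpow_deriv {X : Type*} [MeasurableSpace X] (μ : Measure X) (q : ℝ) :
    HasPowerLipschitzDeriv.ConstBounded μ q (q * |(0 : ℝ)| ^ (q - 2) * 0) 0 := by
  simpa using constBounded_zero μ q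

theorem concaveOn_integral_regKernelPrimitive {X : Type*} [MeasurableSpace X] {μ : Measure X}
    [IsFiniteMeasure μ] [Fact (1 ≤ ENNReal.ofReal 2)] {γ ε : ℝ} (hγ : 0 < γ) (hε : 0 < ε) :
    ConcaveOn ℝ Set.univ
      fun f : Lp ℝ (ENNReal.ofReal 2) μ => ∫ x, regKernelPrimitive γ ε (f x) ∂μ := by
  have hint := (hasPowerLipschitzDeriv_regKernelPrimitive hγ hε).integrable_comp
    (constBounded_of_isFiniteMeasure (μ := μ) one_le_two (regKernel γ ε 0))
  refine ⟨convex_univ, fun f _ g _ b c hb hc hbc => ?_⟩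
  simp only [smul_eq_mul]
  rw [← integral_const_mul, ← integral_const_mul,
    ← integral_add ((hint f).const_mul b) ((hint g).const_mul c)]
  refine integral_mono_ae (((hint f).const_mul b).add ((hint g).const_mul c)) (hint _) ?_
  filter_upwards [Lp.coeFn_add (b • f) (c • g), Lp.coeFn_smul b f, Lp.coeFn_smul c g]
    with x h1 h2 h3
  simp only [h1, h2, h3, Pi.add_apply, Pi.smul_apply]
  exact (concaveOn_regKernelPrimitive hγ hε).2 (Set.mem_univ _) (Set.mem_univ _) hb hc hbc

section Energy

variable {N : ℕ} {s p : ℝ} [Admissible N s p] {a : RN N → ℝ} {γ : ℝ} {n : ℕ}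
  [Fact (1 ≤ ENNReal.ofReal 2)]
  {ι : HomSobolev N s p →L[ℝ] Lp ℝ (ENNReal.ofReal 2) (weightedVolume a)}

theorem integral_regPrimitive_eq (ha : Measurable a) (h0 : ∀ x, 0 ≤ a x)
    (hι : ∀ u, ⇑(ι u) =ᵐ[weightedVolume a] ⇑u) (u : HomSobolev N s p) :
    ∫ x, regPrimitive a γ n x (u x) =
      ∫ x, regKernelPrimitive γ (1 / (n : ℝ)) (ι u x) ∂(weightedVolume a) := by
  simp only [regPrimitive_eq]
  rw [← integral_weightedVolume ha h0 fun x => regKernelPrimitive γ (1 / (n : ℝ)) (u x)]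
  refine integral_congr_ae ?_
  filter_upwards [hι u] with x hx
  rw [hx]

theorem energy_eq (ha : Measurable a) (h0 : ∀ x, 0 ≤ a x)
    (hι : ∀ u, ⇑(ι u) =ᵐ[weightedVolume a] ⇑u) (u : HomSobolev N s p) :
    energy a γ n u = 1 / p * ‖u‖ ^ p -
      ∫ x, regKernelPrimitive γ (1 / (n : ℝ)) (ι u x) ∂(weightedVolume a) := by
  rw [energy, integral_regPrimitive_eq ha h0 hι]

theorem integrable_regPrimitive (ha : Measurable a) (h0 : ∀ x, 0 ≤ a x) (hint : Integrable a)
    (hγ : 0 < γ) (hn : 1 ≤ n) (hι : ∀ u, ⇑(ι u) =ᵐ[weightedVolume a] ⇑u)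
    (u : HomSobolev N s p) : Integrable fun x => regPrimitive a γ n x (u x) := by
  have := isFiniteMeasure_weightedVolume hint
  have hε : (0 : ℝ) < 1 / n := by positivity
  simp only [regPrimitive_eq]
  rw [← integrable_weightedVolume_iff ha h0]
  refine ((hasPowerLipschitzDeriv_regKernelPrimitive hγ hε).integrable_comp
    (constBounded_of_isFiniteMeasure one_le_two _) (ι u)).congr ?_
  filter_upwards [hι u] with x hx
  rw [hx]

theorem convexOn_energy (ha : Measurable a) (h0 : ∀ x, 0 ≤ a x) (hint : Integrable a)
    (hγ : 0 < γ) (hn : 1 ≤ n) (hι : ∀ u, ⇑(ι u) =ᵐ[weightedVolume a] ⇑u) :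
    ConvexOn ℝ Set.univ (energy a γ n : HomSobolev N s p → ℝ) := by
  have := isFiniteMeasure_weightedVolume hint
  have hε : (0 : ℝ) < 1 / n := by positivity
  have h1 := HomSobolev.convexOn_norm_rpow.sub
    ((concaveOn_integral_regKernelPrimitive (μ := weightedVolume a) hγ hε).comp_linearMap
      ι.toLinearMap)
  exact h1.congr fun u _ => (energy_eq ha h0 hι u).symm

/-- Clarkson's inequality for the norm term, midpoint concavity for the reaction term. The constant
comes from `(1/p) ‖(u - v)/2‖^p`. -/
theorem energy_half_add_le (ha : Measurable a) (h0 : ∀ x, 0 ≤ a x) (hint : Integrable a)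
    (hγ : 0 < γ) (hn : 1 ≤ n) (hι : ∀ u, ⇑(ι u) =ᵐ[weightedVolume a] ⇑u)
    (u v : HomSobolev N s p) :
    energy a γ n ((1 / 2 : ℝ) • (u + v)) + 1 / p * (1 / 2) ^ p * ‖u - v‖ ^ p ≤
      (1 / 2) * (energy a γ n u + energy a γ n v) := by
  have hp : 0 < p := Admissible.p_pos (N := N) (s := s)
  have := isFiniteMeasure_weightedVolume hint
  have hε : (0 : ℝ) < 1 / n := by positivity
  have h1 := (concaveOn_integral_regKernelPrimitive (μ := weightedVolume a) hγ hε).2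
    (Set.mem_univ (ι u)) (Set.mem_univ (ι v)) (by norm_num : (0 : ℝ) ≤ 1 / 2)
    (by norm_num : (0 : ℝ) ≤ 1 / 2) (by norm_num)
  have h2 := mul_le_mul_of_nonneg_left
    (HomSobolev.norm_half_add_rpow_add_norm_half_sub_rpow_le u v) (by positivity : 0 ≤ 1 / p)
  rw [norm_smul (1 / 2 : ℝ) (u - v), Real.mul_rpow (norm_nonneg _) (norm_nonneg _),
    Real.norm_of_nonneg (by norm_num : (0 : ℝ) ≤ 1 / 2)] at h2
  rw [energy_eq ha h0 hι, energy_eq ha h0 hι, energy_eq ha h0 hι]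
  simp only [← map_smul, ← map_add, ← smul_add, smul_eq_mul] at h1 ⊢
  linarith

theorem exists_integral_abs_le (hint : Integrable a) : ∃ B : ℝ, 0 ≤ B ∧
    ∀ u : HomSobolev N s p, ∫ x, |ι u x| ∂(weightedVolume a) ≤ B * ‖u‖ := by
  have := isFiniteMeasure_weightedVolume hint
  refine ⟨(weightedVolume a Set.univ ^ (1 - 1 / (2 : ℝ))).toReal * ‖ι‖, by positivity,
    fun u => (integral_abs_le_of_Lp one_le_two (ι u)).trans ?_⟩
  rw [mul_assoc]
  exact mul_le_mul_of_nonneg_left (ι.le_opNorm u) ENNReal.toReal_nonneg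

/-- Coercivity for fixed `n`, using the linear bound of the primitive with constant `n^γ`; the
resulting `K` depends on `n`. -/
theorem exists_norm_sub_le_energy (ha : Measurable a) (h0 : ∀ x, 0 ≤ a x) (hint : Integrable a)
    (hγ : 0 < γ) (hn : 1 ≤ n) (hι : ∀ u, ⇑(ι u) =ᵐ[weightedVolume a] ⇑u) :
    ∃ K : ℝ, ∀ u : HomSobolev N s p, ‖u‖ - K ≤ energy a γ n u := by
  have := isFiniteMeasure_weightedVolume hint
  have hε : (0 : ℝ) < 1 / n := by positivity
  have hp2 : 2 ≤ p := Admissible.two_le N s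
  obtain ⟨B, hB, hBu⟩ := exists_integral_abs_le (ι := ι) hint
  set C := (1 / (n : ℝ)) ^ (-γ) * B
  -- Obtained by completing the square in `(1/p)(t² - 1) - C t ≥ t - K`.
  refine ⟨1 / p + p * (C + 1) ^ 2 / 4, fun u => ?_⟩
  have h1 : ∫ x, regKernelPrimitive γ (1 / (n : ℝ)) (ι u x) ∂(weightedVolume a) ≤ C * ‖u‖ := by
    have h2 := ((integrable_of_Lp (one_le_two (α := ℝ)) (ι u)).abs).const_mul ((1 / (n : ℝ)) ^ (-γ))
    have h3 := norm_integral_le_of_norm_le (f := fun x => regKernelPrimitive γ (1 / (n : ℝ)) (ι u x))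
      h2 (Eventually.of_forall fun x => abs_regKernelPrimitive_le hγ hε (ι u x))
    rw [integral_const_mul] at h3
    refine (le_abs_self _).trans (h3.trans ?_)
    rw [mul_assoc]
    exact mul_le_mul_of_nonneg_left (hBu u) (by positivity)
  rw [energy_eq ha h0 hι]
  have h2 := mul_le_mul_of_nonneg_left (sq_sub_one_le_rpow hp2 (norm_nonneg u))
    (by positivity : 0 ≤ 1 / p)
  have h3 : 0 ≤ 1 / p * (‖u‖ - p * (C + 1) / 2) ^ 2 := by positivity
  have h4 : 1 / p * (‖u‖ - p * (C + 1) / 2) ^ 2 =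
      1 / p * ‖u‖ ^ 2 - (C + 1) * ‖u‖ + p * (C + 1) ^ 2 / 4 := by
    field_simp
    ring
  linarith

theorem energy_modulus_le (ha : Measurable a) (h0 : ∀ x, 0 ≤ a x) (hint : Integrable a)
    (hγ : 0 < γ) (hn : 1 ≤ n) (hι : ∀ u, ⇑(ι u) =ᵐ[weightedVolume a] ⇑u)
    (u : HomSobolev N s p) : energy a γ n u.modulus ≤ energy a γ n u := by
  have hp : 0 < p := Admissible.p_pos (N := N) (s := s)
  have hε : (0 : ℝ) < 1 / n := by positivity
  refine sub_le_sub (mul_le_mul_of_nonneg_left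
    (Real.rpow_le_rpow (norm_nonneg _) u.norm_modulus_le hp.le) (by positivity)) ?_
  refine integral_mono_ae (integrable_regPrimitive ha h0 hint hγ hn hι u)
    (integrable_regPrimitive ha h0 hint hγ hn hι _) ?_
  filter_upwards [u.coe_modulus] with x hx
  rw [hx, regPrimitive_eq, regPrimitive_eq]
  exact mul_le_mul_of_nonneg_left (monotone_regKernelPrimitive hε (le_abs_self _)) (h0 x)

theorem energy_zero (ha : Measurable a) (h0 : ∀ x, 0 ≤ a x)
    (hι : ∀ u, ⇑(ι u) =ᵐ[weightedVolume a] ⇑u) :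
    energy a γ n (0 : HomSobolev N s p) = 0 := by
  have hp : 0 < p := Admissible.p_pos (N := N) (s := s)
  rw [energy_eq ha h0 hι, norm_zero, Real.zero_rpow hp.ne', mul_zero, zero_sub, neg_eq_zero,
    map_zero]
  refine (integral_congr_ae ?_).trans (integral_zero _ _)
  filter_upwards [Lp.coeFn_zero ℝ (ENNReal.ofReal 2) (weightedVolume a)] with x hx
  rw [hx, Pi.zero_apply, regKernelPrimitive_zero]

/-- Here `regKernelPrimitive_le` is used in place of the bound by `n^γ`, so `M` is chosen before
`n`. -/
theorem exists_norm_le_of_energy_nonpos (ha : Measurable a) (h0 : ∀ x, 0 ≤ a x)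
    (hint : Integrable a) (hγ : 0 < γ) (hγ1 : γ < 1)
    (hι : ∀ u, ⇑(ι u) =ᵐ[weightedVolume a] ⇑u) :
    ∃ M : ℝ, ∀ n : ℕ, 1 ≤ n → ∀ u : HomSobolev N s p, energy a γ n u ≤ 0 → ‖u‖ ≤ M := by
  have := isFiniteMeasure_weightedVolume hint
  have hp2 : 2 ≤ p := Admissible.two_le N s
  have hγ' : 0 < 1 - γ := by linarith
  obtain ⟨B, hB, hBu⟩ := exists_integral_abs_le (ι := ι) hint
  set m := (weightedVolume a).real Set.univ
  have hm : 0 ≤ m := measureReal_nonneg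
  -- The bound has the form `1 + c₁ + c₂`, since `t² ≤ 1 + c₁ + c₂ t` with `c₁, c₂ ≥ 0` forces `t ≤
  -- 1 + c₁ + c₂`.
  refine ⟨1 + p * ((1 - γ)⁻¹ * m) + p * ((1 - γ)⁻¹ * B), fun n hn u hu => ?_⟩
  have hε : (0 : ℝ) < 1 / n := by positivity
  have h1 : ∫ x, regKernelPrimitive γ (1 / (n : ℝ)) (ι u x) ∂(weightedVolume a) ≤
      (1 - γ)⁻¹ * (m + B * ‖u‖) := by
    have hi := integrable_of_Lp (one_le_two (α := ℝ)) (ι u)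
    have h2 := integral_mono ((hasPowerLipschitzDeriv_regKernelPrimitive hγ hε).integrable_comp
      (constBounded_of_isFiniteMeasure one_le_two _) (ι u))
      (((integrable_const (1 : ℝ)).add hi.abs).const_mul (1 - γ)⁻¹)
      fun x => regKernelPrimitive_le hγ hγ1 hε (ι u x)
    refine h2.trans ?_
    rw [integral_const_mul]
    refine mul_le_mul_of_nonneg_left ?_ (by positivity)
    have h3 := integral_add (integrable_const (1 : ℝ)) hi.abs
    simp only [Pi.add_apply]
    rw [h3, integral_const, smul_eq_mul, mul_one]
    linarith [hBu u]
  rw [energy_eq ha h0 hι] at hu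
  have h2 : ‖u‖ ^ p ≤ p * ((1 - γ)⁻¹ * (m + B * ‖u‖)) := by
    have h3 := mul_le_mul_of_nonneg_left (show 1 / p * ‖u‖ ^ p ≤ (1 - γ)⁻¹ * (m + B * ‖u‖) by linarith)
      (by linarith : 0 ≤ p)
    rwa [← mul_assoc, mul_one_div_cancel (by linarith), one_mul] at h3
  have h3 := sq_sub_one_le_rpow hp2 (norm_nonneg u)
  set c₁ := p * ((1 - γ)⁻¹ * m) with hc₁
  set c₂ := p * ((1 - γ)⁻¹ * B) with hc₂
  have hc₁0 : 0 ≤ c₁ := by positivity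
  have hc₂0 : 0 ≤ c₂ := by positivity
  have h4 : ‖u‖ ^ 2 ≤ 1 + c₁ + c₂ * ‖u‖ := by
    have : p * ((1 - γ)⁻¹ * (m + B * ‖u‖)) = c₁ + c₂ * ‖u‖ := by rw [hc₁, hc₂]; ring
    linarith
  by_contra! hlt
  nlinarith [norm_nonneg u]

variable [Fact (1 ≤ ENNReal.ofReal p)]

/-- Exhibits both terms as integral functionals composed with continuous linear maps, so that the
chain rule applies. -/
theorem energy_eq_integral_sub_integral (ha : Measurable a) (h0 : ∀ x, 0 ≤ a x)
    (hι : ∀ u, ⇑(ι u) =ᵐ[weightedVolume a] ⇑u) :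
    (energy a γ n : HomSobolev N s p → ℝ) = fun u =>
      1 / p * (∫ z, |HomSobolev.diffQuotLI u z| ^ p) -
      ∫ x, regKernelPrimitive γ (1 / (n : ℝ)) (ι u x) ∂(weightedVolume a) := by
  have hp : 0 < p := Admissible.p_pos (N := N) (s := s)
  funext u
  rw [energy_eq ha h0 hι, integral_abs_rpow_eq_norm_rpow hp, LinearIsometry.norm_map]

theorem hasFDerivAt_energy (ha : Measurable a) (h0 : ∀ x, 0 ≤ a x)
    [IsFiniteMeasure (weightedVolume a)] (hγ : 0 < γ) (hε : (0 : ℝ) < 1 / n)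
    (hι : ∀ u, ⇑(ι u) =ᵐ[weightedVolume a] ⇑u) (u : HomSobolev N s p) :
    HasFDerivAt (energy a γ n : HomSobolev N s p → ℝ)
      ((1 / p) • ((hasPowerLipschitzDeriv_abs_rpow (Admissible.two_le N s)).integralDeriv
          (constBounded_abs_rpow_deriv _ p) (HomSobolev.diffQuotLI u)).comp HomSobolev.diffQuotLI.toContinuousLinearMap -
        ((hasPowerLipschitzDeriv_regKernelPrimitive hγ hε).integralDeriv
          (constBounded_of_isFiniteMeasure one_le_two _) (ι u)).comp ι) u := by
  rw [energy_eq_integral_sub_integral ha h0 hι]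
  have h1 := (hasPowerLipschitzDeriv_abs_rpow (Admissible.two_le N s)).hasFDerivAt_integral
    (constBounded_abs_rpow_deriv _ p) (HomSobolev.diffQuotLI u)
  have h2 := (hasPowerLipschitzDeriv_regKernelPrimitive hγ hε).hasFDerivAt_integral
    (constBounded_of_isFiniteMeasure (μ := weightedVolume a) one_le_two _) (ι u)
  have h3 := h1.comp u (HomSobolev.diffQuotLI (N := N) (s := s)
    (p := p)).toContinuousLinearMap.hasFDerivAt
  have h4 := h2.comp u ι.hasFDerivAt
  exact (h3.const_mul (1 / p)).sub h4

theorem contDiff_energy (ha : Measurable a) (h0 : ∀ x, 0 ≤ a x) (hint : Integrable a)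
    (hγ : 0 < γ) (hn : 1 ≤ n) (hι : ∀ u, ⇑(ι u) =ᵐ[weightedVolume a] ⇑u) :
    ContDiff ℝ 1 (energy a γ n : HomSobolev N s p → ℝ) := by
  have := isFiniteMeasure_weightedVolume hint
  have hε : (0 : ℝ) < 1 / n := by positivity
  rw [energy_eq_integral_sub_integral ha h0 hι]
  have h1 := ((hasPowerLipschitzDeriv_abs_rpow (Admissible.two_le N s)).contDiff_integral
    (constBounded_abs_rpow_deriv (volume : Measure (RN N × RN N)) p)).comp
    (HomSobolev.diffQuotLI (N := N) (s := s) (p := p)).contDiff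
  have h2 := ((hasPowerLipschitzDeriv_regKernelPrimitive hγ hε).contDiff_integral
    (constBounded_of_isFiniteMeasure (μ := weightedVolume a) one_le_two _)).comp ι.contDiff
  exact (contDiff_const.mul h1).sub h2

theorem isWeakSolution_of_forall_energy_le (ha : Measurable a) (h0 : ∀ x, 0 ≤ a x)
    (hint : Integrable a) (hγ : 0 < γ) (hn : 1 ≤ n)
    (hι : ∀ u, ⇑(ι u) =ᵐ[weightedVolume a] ⇑u) {u : HomSobolev N s p}
    (hu : ∀ v : HomSobolev N s p, energy a γ n u ≤ energy a γ n v) :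
    IsWeakSolution (regReaction a γ n) u := by
  have := isFiniteMeasure_weightedVolume hint
  have hε : (0 : ℝ) < 1 / n := by positivity
  have hp : 0 < p := Admissible.p_pos (N := N) (s := s)
  intro v
  have hD : IsLocalMin (energy a γ n : HomSobolev N s p → ℝ) u := Eventually.of_forall hu
  have h1 := DFunLike.congr_fun
    (hD.hasFDerivAt_eq_zero (hasFDerivAt_energy ha h0 hγ hε hι u)) v
  simp only [_root_.sub_apply, _root_.smul_apply, ContinuousLinearMap.comp_apply,
    HasPowerLipschitzDeriv.integralDeriv_apply, _root_.zero_apply, smul_eq_mul,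
    LinearIsometry.coe_toContinuousLinearMap] at h1
  -- The factor `1/p` of the energy cancels the `p` from differentiating `|t|^p`.
  have hleft : (fun z => 1 / p * (p * |HomSobolev.diffQuotLI u z| ^ (p - 2) *
      HomSobolev.diffQuotLI u z * HomSobolev.diffQuotLI v z)) =ᵐ[volume]
      fracPLaplacianIntegrand s p u v := by
    filter_upwards [HomSobolev.coe_diffQuotLI u, HomSobolev.coe_diffQuotLI v] with z hz1 hz2
    rw [hz1, hz2, fracPLaplacianIntegrand_eq hp]
    field_simp
  have hright : (fun x => regKernel γ (1 / (n : ℝ)) (ι u x) * ι v x) =ᵐ[weightedVolume a]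
      fun x => regKernel γ (1 / (n : ℝ)) (u x) * v x := by
    filter_upwards [hι u, hι v] with x hx1 hx2
    rw [hx1, hx2]
  have e : ∀ x, regReaction a γ n x (u x) * v x =
      a x * (regKernel γ (1 / (n : ℝ)) (u x) * v x) := fun x => mul_assoc _ _ _
  refine ⟨?_, ?_, ?_⟩
  · exact ((hasPowerLipschitzDeriv_abs_rpow (Admissible.two_le N s)).integrable_deriv_mul
      (constBounded_abs_rpow_deriv _ p) (HomSobolev.diffQuotLI u) (HomSobolev.diffQuotLI v)).const_mul (1 / p) |>.congr hleft
  · simp only [e]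
    rw [← integrable_weightedVolume_iff ha h0]
    exact ((hasPowerLipschitzDeriv_regKernelPrimitive hγ hε).integrable_deriv_mul
      (constBounded_of_isFiniteMeasure one_le_two _) (ι u) (ι v)).congr hright
  · simp only [e]
    rw [← integral_weightedVolume ha h0, ← integral_congr_ae hleft, ← integral_congr_ae hright,
      integral_const_mul]
    linarith

end Energy

end

/-! ### The main theorem -/

theorem theorem3p2 {N : ℕ} {s p : ℝ} [Admissible N s p]
    {γ α ca : ℝ} (hγ0 : 0 < γ) (hγ1 : γ < 1)
    (hα : α ∈ Set.Ioo (γ * ((N - s * p) / (p - 1))) (γ * ((N - s * p) / (p - 1)) + s * p))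
    (hca : 0 < ca)
    (a : RN N → ℝ) (ha : Measurable a)
    (haw : ∀ x, 0 ≤ a x ∧ a x ≤ ca * weight α x) :
    -- the energy functionals are well defined, of class `C^1`, weakly l.s.c. and coercive
    (∀ n : ℕ, 1 ≤ n →
      (∀ u : HomSobolev N s p, Integrable (fun x => regPrimitive a γ n x (u x))) ∧
      ContDiff ℝ 1 (energy a γ n : HomSobolev N s p → ℝ) ∧
      LowerSemicontinuous (fun u : WeakSpace ℝ (HomSobolev N s p) =>
        energy a γ n ((toWeakSpace ℝ (HomSobolev N s p)).symm u)) ∧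
      Tendsto (energy a γ n : HomSobolev N s p → ℝ)
        (Bornology.cobounded (HomSobolev N s p)) atTop) ∧
    -- they have nonnegative minimizers, which are weak solutions and form a bounded sequence
    ∃ u : ℕ → HomSobolev N s p,
      (∀ n : ℕ, 1 ≤ n →
        (∀ v : HomSobolev N s p, energy a γ n (u n) ≤ energy a γ n v) ∧
        IsWeakSolution (regReaction a γ n) (u n) ∧
        ∀ᵐ x, 0 ≤ u n x) ∧
      ∃ M : ℝ, ∀ n : ℕ, 1 ≤ n → ‖u n‖ ≤ M := by
  have hfact2 : Fact ((1 : ℝ≥0∞) ≤ ENNReal.ofReal 2) := ⟨by simp⟩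
  have hp2 : 2 ≤ p := Admissible.two_le N s
  have hfactp : Fact (1 ≤ ENNReal.ofReal p) := ⟨by simp; linarith⟩
  -- Positivity of `α` makes the weight, and hence `a`, integrable.
  have hα0 : 0 < α := by
    have h1 := Admissible.mul_lt (N := N) (s := s) (p := p)
    refine lt_trans (mul_pos hγ0 (div_pos ?_ ?_)) hα.1 <;> linarith
  have h0 : ∀ x, 0 ≤ a x := fun x => (haw x).1
  have hint : Integrable a := by
    refine ((integrable_weight hα0).const_mul ca).mono' ha.aestronglyMeasurable
      (Eventually.of_forall fun x => ?_)
    rw [Real.norm_of_nonneg (h0 x)]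
    exact (haw x).2
  have hle : ∀ x, a x ≤ ca := fun x =>
    (haw x).2.trans (mul_le_of_le_one_right hca.le (weight_le_one α x))
  obtain ⟨ι, hι⟩ := exists_embedding_weightedVolume (N := N) (s := s) (p := p) hle hint
  have hcont : ∀ n : ℕ, 1 ≤ n → ContDiff ℝ 1 (energy a γ n : HomSobolev N s p → ℝ) :=
    fun n hn => contDiff_energy ha h0 hint hγ0 hn hι
  refine ⟨fun n hn => ⟨integrable_regPrimitive ha h0 hint hγ0 hn hι, hcont n hn,
    (convexOn_energy ha h0 hint hγ0 hn hι).lowerSemicontinuous_weakSpace (hcont n hn).continuous,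
    ?_⟩, ?_⟩
  · obtain ⟨K, hK⟩ := exists_norm_sub_le_energy ha h0 hint hγ0 hn hι
    exact tendsto_atTop_mono hK (tendsto_atTop_add_const_right _ (-K) tendsto_norm_cobounded_atTop)
  · have hmin : ∀ n : ℕ, ∃ u : HomSobolev N s p, 1 ≤ n →
        (∀ v : HomSobolev N s p, energy a γ n u ≤ energy a γ n v) ∧ ∀ᵐ x, 0 ≤ u x := by
      intro n
      by_cases hn : 1 ≤ n
      · obtain ⟨K, hK⟩ := exists_norm_sub_le_energy ha h0 hint hγ0 hn hι
        obtain ⟨u, hu⟩ := exists_forall_le_of_uniformly_convex (hcont n hn).continuous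
          ⟨-K, by rintro _ ⟨u, rfl⟩; linarith [hK u, norm_nonneg u]⟩
          (by positivity : 0 < 1 / p * (1 / 2) ^ p) (by linarith : 0 < p)
          (energy_half_add_le ha h0 hint hγ0 hn hι)
        -- The modulus of a minimizer has no larger energy, so it is a minimizer as well.
        refine ⟨u.modulus, fun _ =>
          ⟨fun v => (energy_modulus_le ha h0 hint hγ0 hn hι u).trans (hu v), ?_⟩⟩
        filter_upwards [u.coe_modulus] with x hx
        rw [hx]
        exact abs_nonneg _
      -- The index `n = 0` carries no claim; any element serves.
      · exact ⟨0, fun h => absurd h hn⟩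
    choose u hu using hmin
    obtain ⟨M, hM⟩ := exists_norm_le_of_energy_nonpos ha h0 hint hγ0 hγ1 hι
    refine ⟨u, fun n hn => ⟨(hu n hn).1,
      isWeakSolution_of_forall_energy_le ha h0 hint hγ0 hn hι (hu n hn).1, (hu n hn).2⟩,
      M, fun n hn => hM n hn (u n) ?_⟩
    -- Comparison with the competitor `0` gives nonpositive energy.
    exact ((hu n hn).1 0).trans (energy_zero ha h0 hι).le
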